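/- Let $d\in\mathbb N$ and let $A$ be the integro-differential operator $$Au(x)=\tfrac12\mathrm{Tr}\big(\mathbf Q(x)\nabla^2u(x)\big)+b(x)\cdot\nabla u(x)+\int_{\mathbb R^d}\Big(u(x+y)-u(x)-\frac{y\cdot\nabla u(x)}{1+|y|^2}\Big)N(x,dy),\qquad x\in\mathbb R^d,$$ where $\mathbf Q=[q_{i,j}]$ and $b$ are bounded and Borel measurable, $\sum_{i,j}q_{i,j}(x)\xi_i\xi_j\ge0$ for all $x,\xi\in\mathbb R^d$, and $N$ is a Lévy kernel: $N(x,\cdot)$ is a Borel measure on $\mathbb R^d\setminus\{0\}$ for each $x$, measurable in $x$, with $\sup_{x}\int\min\{1,|y|^2\}\,N(x,dy)<\infty$. Let $(P_x)_{x\in\mathbb R^d}$ be a strong Markovian solution of the martingale problem for $A$ on the space of càdlàg paths $[0,\infty)\to\mathbb R^d$ with canonical process $(X_t)$ and natural filtration $(\mathcal F_t)$. That is: $x\mapsto P_x[C]$ is measurable for every measurable set $C$ of paths; $(X_t)$ is strongly Markovian with respect to $(\mathcal F_t)$ and $(P_x)$; each $P_x$ solves the martingale problem with initial law $\delta_x$;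 and for every Borel probability measure $\mu$ on $\mathbb R^d$ the measure $\int P_x\,\mu(dx)$ solves it with initial law $\mu$. Here a probability measure $P_\mu$ solves the martingale problem with initial law $\mu$ if $X_0$ has law $\mu$ under $P_\mu$ and, for every $f\in C^2(\mathbb R^d)$ that is bounded together with its first two derivatives, $f(X_t)-f(X_0)-\int_0^tAf(X_r)\,dr$ is an $(\mathcal F_t)$-martingale under $P_\mu$. Let $D\subset\mathbb R^d$ be a domain (non-empty, open and connected), let $\tau_D=\inf\{t>0:X_t\notin D\}$, and assume $P_x[\tau_D<\infty]=1$ for all $x\in D$. Let $m$ be a $\sigma$-finite Borel measure on $\mathbb R^d$ with $m(D)>0$. Let $B_b^+(D)$ be the set of bounded non-negative Borel functions on $D$; for $f\in B_b^+(D)$ and $\alpha>0$ put $$P^D_tf(x)=\mathbb E_x[f(X_t),\,t<\tau_D],\qquad R^D_\alpha f(x)=\int_0^\infty e^{-\alpha t}P^D_tf(x)\,dt,\qquad x\in D.$$ The resolvent is called $m$-irreducible (IR$_m$) if $R^D_1f(x)>0$ for all $x\in D$ and all $f\in B_b^+(D)$ with $\int_Df\,dm>0$. For $c\in B_b^+(D)$,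 a bounded Borel function $u:\mathbb R^d\to\mathbb R$ is a weak subsolution of $(-A+c)v=0$ in $D$ if $$u(x)\le\mathbb E_x\Big[\exp\Big\{-\int_0^{\tau_D\wedge t}c(X_r)\,dr\Big\}\,u(X_{\tau_D\wedge t})\Big]\qquad\text{for all }x\in D,\ t\ge0.$$ Let $\mathcal S(D)=\bigcup_{x\in D}\{x+y:y\in\mathrm{supp}\,N(x,\cdot)\}$ and $D_S=D\cup\partial D\cup\mathcal S(D)$. The operator $A$ satisfies the strong maximum principle (SMP) if for every $c\in B_b^+(D)$ and every weak subsolution $u$ of $(-A+c)v=0$ in $D$ such that $u(\hat x)=\sup_{D_S}u\ge0$ for some $\hat x\in D$, one has $u=\sup_{D_S}u$ $m$-a.e. in $D$. Then: (i) IR$_m$ implies the SMP for $A$. (ii) If, in addition, $$\limsup_{\alpha\to+\infty}\alpha\int_DR^D_\alpha f\,dm>0\qquad\text{for every }f\in B_b^+(D)\text{ with }\int_Df\,dm>0,$$ then the SMP for $A$ implies IR$_m$. -/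

import Mathlib

open MeasureTheory ProbabilityTheory Set Filter
open scoped NNReal ENNReal Topology

noncomputable section

/-- Euclidean space `ℝ^d`. -/
abbrev Euc (d : ℕ) : Type := EuclideanSpace ℝ (Fin d)

/-! ### The operator `A` -/

/-- `A u (x) = ½ Tr(Q(x) ∇²u(x)) + b(x) · ∇u(x)
      + ∫ (u(x+y) - u(x) - y · ∇u(x) / (1 + |y|²)) N(x, dy)`. -/
def integroDiffOp {d : ℕ} (Q : Euc d → Matrix (Fin d) (Fin d) ℝ) (b : Euc d → Euc d)
    (N : Kernel (Euc d) (Euc d)) (u : Euc d → ℝ) (x : Euc d) : ℝ :=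
  (1 / 2 : ℝ) * (∑ i, ∑ j, Q x i j *
      iteratedFDeriv ℝ 2 u x ![EuclideanSpace.single i 1, EuclideanSpace.single j 1])
    + fderiv ℝ u x (b x)
    + ∫ y, (u (x + y) - u x - fderiv ℝ u x y / (1 + ‖y‖ ^ 2)) ∂(N x)

/-- The coefficients `q_{ij}`, `b_i` are bounded and Borel measurable, and `Q(x)` is non-negative
definite, in the sense `∑ q_{ij}(x) ξ_i ξ_j ≥ 0`, for every `x`. -/
structure LocalCoeffCond {d : ℕ} (Q : Euc d → Matrix (Fin d) (Fin d) ℝ)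
    (b : Euc d → Euc d) : Prop where
  measurable_Q : ∀ i j, Measurable fun x => Q x i j
  bounded_Q : ∃ C : ℝ, ∀ x i j, |Q x i j| ≤ C
  measurable_b : Measurable b
  bounded_b : ∃ C : ℝ, ∀ x, ‖b x‖ ≤ C
  nonneg_Q : ∀ x (ξ : Euc d), 0 ≤ ∑ i, ∑ j, Q x i j * ξ i * ξ j

/-- `N` is a Lévy kernel: every `N(x, ·)` is a measure on `ℝ^d ∖ {0}` (i.e. has no mass at `0`) and
`sup_x ∫ min(1, |y|²) N(x, dy) < ∞`. (Each `N(x, ·)` is then automatically `σ`-finite.) -/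
structure LevyKernelCond {d : ℕ} (N : Kernel (Euc d) (Euc d)) : Prop where
  zero_singleton : ∀ x, N x {0} = 0
  bounded : ∃ C : ℝ≥0, ∀ x, ∫⁻ y, ENNReal.ofReal (min 1 (‖y‖ ^ 2)) ∂(N x) ≤ C

/-- The class `C_b²(ℝ^d)`: `C²` functions, bounded together with their first two derivatives. -/
def IsCb2 {d : ℕ} (f : Euc d → ℝ) : Prop :=
  ContDiff ℝ 2 f ∧
    ∃ C : ℝ, ∀ x, |f x| ≤ C ∧ ‖fderiv ℝ f x‖ ≤ C ∧ ‖iteratedFDeriv ℝ 2 f x‖ ≤ C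

/-- Range of non-locality over `D`: `⋃_{x ∈ D} {x + y : y ∈ supp N(x, ·)}`. -/
def nonlocalRange {d : ℕ} (N : Kernel (Euc d) (Euc d)) (D : Set (Euc d)) : Set (Euc d) :=
  ⋃ x ∈ D, (fun y => x + y) '' (N x).support

/-- Extended boundary `∂_S D = ∂D ∪ (S(D) ∖ D)`. -/
def extBoundary {d : ℕ} (N : Kernel (Euc d) (Euc d)) (D : Set (Euc d)) : Set (Euc d) :=
  frontier D ∪ (nonlocalRange N D \ D)

/-- `D_S = ∂_S D ∪ D`. -/
def extDomain {d : ℕ} (N : Kernel (Euc d) (Euc d)) (D : Set (Euc d)) : Set (Euc d) :=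
  extBoundary N D ∪ D

/-! ### The canonical path space -/

/-- Càdlàg paths `[0, ∞) → ℝ^d`. -/
structure CadlagPath (d : ℕ) where
  toFun : ℝ≥0 → Euc d
  right_cont : ∀ t, ContinuousWithinAt toFun (Ici t) t
  left_lim : ∀ t, ∃ l, Tendsto toFun (𝓝[<] t) (𝓝 l)

namespace CadlagPath

instance {d : ℕ} : CoeFun (CadlagPath d) (fun _ => ℝ≥0 → Euc d) := ⟨CadlagPath.toFun⟩

/-- The `σ`-algebra generated by the coordinate maps `X_t`; it is the Borel `σ`-algebra of the
Skorokhod topology. -/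
instance instMeasurableSpace {d : ℕ} : MeasurableSpace (CadlagPath d) :=
  ⨆ t : ℝ≥0, MeasurableSpace.comap (fun ω : CadlagPath d => ω t) inferInstance

theorem measurable_eval {d : ℕ} (t : ℝ≥0) : Measurable fun ω : CadlagPath d => ω t :=
  Measurable.of_comap_le (le_iSup (fun t : ℝ≥0 =>
    MeasurableSpace.comap (fun ω : CadlagPath d => ω t) inferInstance) t)

/-- The natural filtration `ℱ_t = σ(X_s, 0 ≤ s ≤ t)` of the canonical process. -/
def natFiltration (d : ℕ) :
    Filtration ℝ≥0 (instMeasurableSpace (d := d)) :=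
  Filtration.natural (fun (t : ℝ≥0) (ω : CadlagPath d) => ω t)
    fun t => (measurable_eval t).stronglyMeasurable

/-- The shift `θ_t ω (s) = ω (t + s)`. -/
def shift {d : ℕ} (t : ℝ≥0) (ω : CadlagPath d) : CadlagPath d where
  toFun s := ω (t + s)
  right_cont s := by
    refine ContinuousWithinAt.comp (t := Ici (t + s)) (ω.right_cont (t + s))
      (by fun_prop) ?_
    intro r hr
    exact add_le_add_right (mem_Ici.mp hr) t
  left_lim s := by
    obtain ⟨l, hl⟩ := ω.left_lim (t + s)
    refine ⟨l, hl.comp ?_⟩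
    refine tendsto_nhdsWithin_iff.mpr ⟨?_, ?_⟩
    · exact ((continuous_const.add continuous_id).tendsto s).mono_left nhdsWithin_le_nhds
    · filter_upwards [self_mem_nhdsWithin] with r hr
      exact add_lt_add_right (mem_Iio.mp hr) t

/-- Exit time `τ_D = inf {t > 0 : X_t ∉ D}`, with `inf ∅ = ∞`. -/
def exitTime {d : ℕ} (D : Set (Euc d)) (ω : CadlagPath d) : ℝ≥0∞ :=
  ⨅ (t : ℝ≥0) (_ : 0 < t ∧ ω t ∉ D), (t : ℝ≥0∞)

/-- `τ_D ∧ t`, a finite time. -/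
def exitTimeMin {d : ℕ} (D : Set (Euc d)) (t : ℝ≥0) (ω : CadlagPath d) : ℝ≥0 :=
  (min (exitTime D ω) t).toNNReal

/-- `e_c(t) = exp (-∫_0^t c(X_r) dr)`. -/
def expFunctional {d : ℕ} (c : Euc d → ℝ) (t : ℝ≥0) (ω : CadlagPath d) : ℝ :=
  Real.exp (-∫ r in (0 : ℝ)..t, c (ω r.toNNReal))

end CadlagPath

open CadlagPath

/-! ### The martingale problem -/

/-- `M_t[f] = f(X_t) - f(X_0) - ∫_0^t A f(X_r) dr`. -/
def mpProcess {d : ℕ} (Q : Euc d → Matrix (Fin d) (Fin d) ℝ) (b : Euc d → Euc d)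
    (N : Kernel (Euc d) (Euc d)) (f : Euc d → ℝ) (t : ℝ≥0) (ω : CadlagPath d) : ℝ :=
  f (ω t) - f (ω 0) - ∫ r in (0 : ℝ)..t, integroDiffOp Q b N f (ω r.toNNReal)

/-- `Pμ` solves the martingale problem for `A` with initial distribution `μ`. -/
structure IsMartingaleSolution {d : ℕ} (Q : Euc d → Matrix (Fin d) (Fin d) ℝ)
    (b : Euc d → Euc d) (N : Kernel (Euc d) (Euc d)) (μ : Measure (Euc d))
    (Pμ : Measure (CadlagPath d)) : Prop where
  isProbabilityMeasure : IsProbabilityMeasure Pμ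
  initial : Pμ.map (fun ω => ω 0) = μ
  martingale : ∀ f : Euc d → ℝ, IsCb2 f → Martingale (mpProcess Q b N f) (natFiltration d) Pμ

/-- The strong Markov property of the canonical process under `(P_x)`: for every stopping time `σ`
of the natural filtration, every `F ∈ ℱ_σ` and every measurable set `B` of paths,
`P_x(F, σ < ∞, θ_σ ∈ B) = E_x[P_{X_σ}(B); F, σ < ∞]`. -/
def IsStrongMarkov {d : ℕ} (P : Kernel (Euc d) (CadlagPath d)) : Prop :=
  ∀ (x : Euc d) (σ : CadlagPath d → WithTop ℝ≥0) (hσ : IsStoppingTime (natFiltration d) σ)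
    (F : Set (CadlagPath d)), MeasurableSet[hσ.measurableSpace] F →
    ∀ B : Set (CadlagPath d), MeasurableSet B →
      P x (F ∩ {ω | σ ω ≠ ⊤ ∧ shift ((σ ω).untopD 0) ω ∈ B}) =
        ∫⁻ ω in F ∩ {ω | σ ω ≠ ⊤}, P (ω ((σ ω).untopD 0)) B ∂(P x)

/-- `(P_x)` is a strong Markovian solution of the martingale problem for `A`. Measurability of
`x ↦ P_x(C)` is part of `P` being a `Kernel`; `P ∘ₘ μ` is the mixture `∫ P_x μ(dx)`. -/
structure IsStrongMarkovSolution {d : ℕ} (Q : Euc d → Matrix (Fin d) (Fin d) ℝ)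
    (b : Euc d → Euc d) (N : Kernel (Euc d) (Euc d))
    (P : Kernel (Euc d) (CadlagPath d)) : Prop where
  solution : ∀ x, IsMartingaleSolution Q b N (Measure.dirac x) (P x)
  strongMarkov : IsStrongMarkov P
  mixture : ∀ μ : Measure (Euc d), IsProbabilityMeasure μ →
    IsMartingaleSolution Q b N μ (P ∘ₘ μ)

/-! ### Semigroup, resolvent, subsolutions, maximum principle -/

/-- `f ∈ B_b⁺(D)`: `f` is Borel measurable, bounded and non-negative on `D`
(the values of `f` outside `D` play no role). -/
def IsBddNonnegOn {d : ℕ} (D : Set (Euc d)) (f : Euc d → ℝ) : Prop :=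
  Measurable (D.domRestrict f) ∧ ∃ C : ℝ, ∀ x ∈ D, 0 ≤ f x ∧ f x ≤ C

/-- `P_t^D f(x) = E_x[f(X_t); t < τ_D]`, for non-negative `f`. -/
def killedSemigroup {d : ℕ} (P : Kernel (Euc d) (CadlagPath d)) (D : Set (Euc d)) (t : ℝ≥0)
    (f : Euc d → ℝ) (x : Euc d) : ℝ≥0∞ :=
  ∫⁻ ω in {ω | (t : ℝ≥0∞) < exitTime D ω}, ENNReal.ofReal (f (ω t)) ∂(P x)

/-- `R_α^D f(x) = ∫_0^∞ e^{-α t} P_t^D f(x) dt`, for non-negative `f`. -/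
def killedResolvent {d : ℕ} (P : Kernel (Euc d) (CadlagPath d)) (D : Set (Euc d)) (α : ℝ)
    (f : Euc d → ℝ) (x : Euc d) : ℝ≥0∞ :=
  ∫⁻ t in Ioi (0 : ℝ), ENNReal.ofReal (Real.exp (-α * t)) * killedSemigroup P D t.toNNReal f x

/-- The exit time from `D` is almost surely finite. -/
def ExitTimeFinite {d : ℕ} (P : Kernel (Euc d) (CadlagPath d)) (D : Set (Euc d)) : Prop :=
  ∀ x ∈ D, ∀ᵐ ω ∂(P x), exitTime D ω < ⊤

/-- `m`-irreducibility of the resolvent: `R_1^D f > 0` everywhere on `D` for every `f ∈ B_b⁺(D)`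
with `∫_D f dm > 0`. -/
def ResolventIrreducible {d : ℕ} (P : Kernel (Euc d) (CadlagPath d)) (D : Set (Euc d))
    (m : Measure (Euc d)) : Prop :=
  ∀ f : Euc d → ℝ, IsBddNonnegOn D f → 0 < ∫⁻ x in D, ENNReal.ofReal (f x) ∂m →
    ∀ x ∈ D, 0 < killedResolvent P D 1 f x

/-- `u ∈ B_b(ℝ^d)` is a weak subsolution of `(-A + c) v = 0` in `D`:
`u(x) ≤ E_x[e_c(τ_D ∧ t) u(X_{τ_D ∧ t})]` for all `x ∈ D`, `t ≥ 0`. -/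
structure IsWeakSubsolution {d : ℕ} (P : Kernel (Euc d) (CadlagPath d)) (D : Set (Euc d))
    (c : Euc d → ℝ) (u : Euc d → ℝ) : Prop where
  measurable : Measurable u
  bounded : ∃ C : ℝ, ∀ x, |u x| ≤ C
  le_expectation : ∀ x ∈ D, ∀ t : ℝ≥0,
    u x ≤ ∫ ω, expFunctional c (exitTimeMin D t ω) ω * u (ω (exitTimeMin D t ω)) ∂(P x)

/-- The strong maximum principle: for every `c ∈ B_b⁺(D)` and every weak subsolution `u` of
`(-A + c) v = 0` in `D`, if `u` attains `sup_{D_S} u ≥ 0` at a point of `D`, then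
`u = sup_{D_S} u` holds `m`-a.e. in `D`. -/
def StrongMaxPrinciple {d : ℕ} (N : Kernel (Euc d) (Euc d)) (P : Kernel (Euc d) (CadlagPath d))
    (D : Set (Euc d)) (m : Measure (Euc d)) : Prop :=
  ∀ c : Euc d → ℝ, IsBddNonnegOn D c → ∀ u : Euc d → ℝ, IsWeakSubsolution P D c u →
    ∀ x₀ ∈ D, u x₀ = sSup (u '' extDomain N D) → 0 ≤ sSup (u '' extDomain N D) →
      ∀ᵐ x ∂(m.restrict D), u x = sSup (u '' extDomain N D)

end

/-!
The theorem compares paths started in `D` with the set `D_S`, and both implications reduce to two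
facts about such paths.

* The exit position: almost surely `X_{τ_D}` lies outside `D`, in the extended boundary
  `∂D ∪ (S(D) ∖ D)` (`ae_exit`). This is where the martingale problem is used.
* The Markov property at deterministic times.

**The exit position.** The martingale problem for a bump function `f`, tested against a weight
`g(X_{t_i})` with `g` supported where `f` vanishes, gives
`E ∑ g(X_{t_i}) f(X_{t_{i+1}}) = E ∫ g(X_{t_i}) Af(X_r) dr`. Refining the grid, Fatou's lemma bounds
the probability of a jump from `{g = 1}` into `{f ≥ 1}` by the integral of `g Af` over the
occupation measure (`measure_jumpEvent_le`), and at points around which `f` vanishes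
`Af(x) = ∫ f(x + y) N(x, dy)`. Outer regularity extends the bound to Borel sets of starting points;
those outside `D`, and those from which `N` does not charge the target, contribute zero
(`measure_jumpEvent_eq_zero`). Countably many bumps then show that, up to the exit from `D`, every
jump starts in `D` and follows the support of the Lévy kernel (`ae_jump_mem_support`).

**Measurability of the exit time.** `τ_D` is a hitting time of a closed set, and its measurability
for the `σ`-algebra of the coordinate maps is not available in general. The argument uses instead
the contact time, at which the path or its left limit first touches `Dᶜ`. The event
`{t < contactTime}` is `staysInside D t`, which belongs to `ℱ_t`. A path whose left limit touches
`Dᶜ` does not jump at that time, by the description of the jumps, so the contact time is almost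
surely equal to `τ_D`.

**Irreducibility implies the maximum principle.** If a subsolution `u` attains its supremum
`M ≥ 0` over `D_S` at `x₀ ∈ D`, then `M ≤ E[e_c u(X_{τ ∧ t})]` while `e_c ≤ 1` and
`u(X_{τ ∧ t}) ≤ M`, so `u(X_{τ ∧ t}) = M` almost surely (`IsWeakSubsolution.ae_eq_sSup`). The
resolvent of the indicator of `{u < M}` vanishes at `x₀`, and irreducibility makes this set
`m`-null in `D`.

**The maximum principle implies irreducibility.** If `R_1 f` vanishes at a point of `D`, so does
`R_α f` for every `α > 0`. By the Markov property `-R_α f`, extended by zero, is a weak subsolution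
with `c = α` (`isWeakSubsolution_neg_resolvent`); it attains its maximum `0` in `D`, so
`R_α f = 0` holds `m`-a.e. in `D` for every `α > 0`, against the assumption on the `limsup`.
-/

noncomputable section

open CadlagPath

/-! ### Càdlàg paths -/

namespace CadlagPath

variable {d : ℕ}

/-- The canonical process is jointly measurable in time and path: by right-continuity it is the
limit of its values at the points of a grid that lie strictly to the right of the time. -/
theorem measurable_uncurry : Measurable fun p : ℝ≥0 × CadlagPath d => p.2 p.1 := by
  have hlim : ∀ t : ℝ≥0, Tendsto (fun n : ℕ => ((⌊t * (n + 1)⌋₊ + 1 : ℕ) : ℝ≥0) / (n + 1)) atTop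
      (𝓝[≥] t) := by
    intro t
    have hle : ∀ n : ℕ, t ≤ ((⌊t * (n + 1)⌋₊ + 1 : ℕ) : ℝ≥0) / (n + 1) := by
      intro n
      rw [le_div_iff₀ (by positivity)]
      push_cast
      exact (Nat.lt_floor_add_one _).le
    refine tendsto_nhdsWithin_iff.mpr ⟨?_, .of_forall hle⟩
    refine tendsto_of_tendsto_of_tendsto_of_le_of_le tendsto_const_nhds
      (h := fun n : ℕ => t + 1 / ((n : ℝ≥0) + 1)) ?_ hle ?_
    · simpa using tendsto_const_nhds.add (tendsto_one_div_add_atTop_nhds_zero_nat (𝕜 := ℝ≥0))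
    · intro n
      change _ / _ ≤ _
      rw [div_le_iff₀ (by positivity), add_mul, one_div, inv_mul_cancel₀ (by positivity)]
      push_cast
      gcongr
      exact Nat.floor_le (by positivity)
  refine measurable_of_tendsto_metrizable
    (f := fun (n : ℕ) (p : ℝ≥0 × CadlagPath d) =>
      p.2 (((⌊p.1 * (n + 1)⌋₊ + 1 : ℕ) : ℝ≥0) / (n + 1))) ?_ ?_
  · intro n
    have h1 : Measurable fun q : ℕ × CadlagPath d => q.2 (((q.1 + 1 : ℕ) : ℝ≥0) / (n + 1)) :=
      measurable_from_prod_countable_right fun k =>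
        measurable_eval (((k + 1 : ℕ) : ℝ≥0) / (n + 1))
    have h2 : Measurable fun p : ℝ≥0 × CadlagPath d => (⌊p.1 * (n + 1)⌋₊, p.2) :=
      (Nat.measurable_floor.comp (measurable_fst.mul_const _)).prodMk measurable_snd
    exact h1.comp h2
  · rw [tendsto_pi_nhds]
    intro p
    exact (p.2.right_cont p.1).tendsto.comp (hlim p.1)

theorem measurable_natFiltration_eval {s t : ℝ≥0} (h : s ≤ t) :
    Measurable[natFiltration d t] fun ω : CadlagPath d => ω s :=
  Measurable.of_comap_le (le_iSup₂_of_le (f := fun (s : ℝ≥0) (_ : s ≤ t) =>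
    MeasurableSpace.comap (fun ω : CadlagPath d => ω s) inferInstance) s h le_rfl)

theorem measurable_shift (t : ℝ≥0) : Measurable (shift (d := d) t) := by
  refine measurable_iff_comap_le.mpr ?_
  refine MeasurableSpace.comap_le_iff_le_map.mpr (iSup_le fun s => ?_)
  rw [← MeasurableSpace.comap_le_iff_le_map, MeasurableSpace.comap_comp]
  exact (measurable_eval (t + s)).comap_le

/-- A càdlàg path has at most countably many jumps, because the jumps of size at least a given
`ε > 0` are isolated from the left. -/
theorem countable_jumps (ω : CadlagPath d) :
    {s : ℝ≥0 | ¬ Tendsto ω (𝓝[<] s) (𝓝 (ω s))}.Countable := by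
  let S : ℕ → Set ℝ≥0 := fun n =>
    {s | 0 < s ∧ ∃ l, Tendsto ω (𝓝[<] s) (𝓝 l) ∧ 1 / ((n : ℝ) + 1) < dist l (ω s)}
  have hS : ∀ n, (S n).Countable := by
    intro n
    refine Set.Countable.mono (fun s hs => ?_)
      (countable_setOfPred_isolated_left_within (s := S n))
    refine mem_sep hs ?_
    rw [inter_comm, nhdsWithin_inter', inf_principal_eq_bot]
    obtain ⟨l, hl⟩ := ω.left_lim s
    have hε : 0 < 1 / ((n : ℝ) + 1) / 2 := by positivity
    have h1 : ∀ᶠ r in 𝓝[<] s, dist (ω r) l < 1 / ((n : ℝ) + 1) / 2 :=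
      hl.eventually (Metric.ball_mem_nhds l hε)
    filter_upwards [h1, eventually_eventually_nhdsWithin.mpr h1, self_mem_nhdsWithin]
      with r hr1 hr2 hrs
    rintro ⟨hr0, k, hk, hkd⟩
    have hne : (𝓝[<] r).NeBot := nhdsLT_neBot_of_exists_lt ⟨0, hr0⟩
    have h2 : ∀ᶠ q in 𝓝[<] r, dist (ω q) l < 1 / ((n : ℝ) + 1) / 2 :=
      nhdsWithin_mono r (Iio_subset_Iio (le_of_lt hrs)) hr2
    have h3 : dist k l ≤ 1 / ((n : ℝ) + 1) / 2 :=
      le_of_tendsto (hk.dist tendsto_const_nhds) (h2.mono fun _ h => h.le)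
    have h4 := dist_triangle_right k (ω r) l
    linarith
  refine (countable_iUnion hS).mono fun s hs => ?_
  obtain ⟨l, hl⟩ := ω.left_lim s
  have hne : l ≠ ω s := fun h => hs (h ▸ hl)
  obtain ⟨n, hn⟩ := exists_nat_one_div_lt (dist_pos.mpr hne)
  refine mem_iUnion.mpr ⟨n, ?_, l, hl, hn⟩
  rcases eq_or_lt_of_le (zero_le (a := s)) with h0 | h0
  · refine absurd ?_ hs
    subst h0
    simp
  · exact h0

/-- The event that the path stays at positive distance from `Dᶜ` up to and including time `t`. -/
def staysInside (D : Set (Euc d)) (t : ℝ≥0) : Set (CadlagPath d) :=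
  {ω | ∃ n : ℕ, ∀ s ≤ t, ((n : ℝ≥0∞) + 1)⁻¹ ≤ Metric.infEDist (ω s) Dᶜ}

/-- The contact time with `Dᶜ`: the first time at which the path, or its left limit, fails to be
inside the open set `D`. In contrast to the exit time it is a stopping time of the raw natural
filtration. -/
def contactTime (D : Set (Euc d)) (ω : CadlagPath d) : ℝ≥0∞ :=
  ⨅ (t : ℝ≥0) (_ : ω ∉ staysInside D t), (t : ℝ≥0∞)

variable {D : Set (Euc d)}

theorem mem_of_mem_staysInside {t s : ℝ≥0} {ω : CadlagPath d} (h : ω ∈ staysInside D t)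
    (hs : s ≤ t) : ω s ∈ D := by
  obtain ⟨n, hn⟩ := h
  by_contra hc
  have h1 := hn s hs
  rw [Metric.infEDist_zero_of_mem hc] at h1
  simp at h1

theorem lt_contactTime_iff {t : ℝ≥0} {ω : CadlagPath d} :
    (t : ℝ≥0∞) < contactTime D ω ↔ ω ∈ staysInside D t := by
  constructor
  · intro h
    by_contra hc
    exact absurd h (not_lt.mpr (iInf₂_le t hc))
  · rintro ⟨n, hn⟩
    have hlt : ((n + 1 : ℕ) + 1 : ℝ≥0∞)⁻¹ < Metric.infEDist (ω t) Dᶜ := by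
      refine lt_of_lt_of_le ?_ (hn t le_rfl)
      rw [ENNReal.inv_lt_inv]
      exact_mod_cast Nat.lt_succ_self _
    have hev : ∀ᶠ s in 𝓝[≥] t, ((n + 1 : ℕ) + 1 : ℝ≥0∞)⁻¹ < Metric.infEDist (ω s) Dᶜ :=
      (Metric.continuous_infEDist.continuousAt.comp_continuousWithinAt
        (ω.right_cont t)).eventually (lt_mem_nhds hlt)
    obtain ⟨u, hu, hsub⟩ := (mem_nhdsGE_iff_exists_Ico_subset).mp hev
    refine lt_of_lt_of_le (ENNReal.coe_lt_coe.mpr hu) (le_iInf₂ fun r hr => ?_)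
    by_contra hc
    refine hr ⟨n + 1, fun s hs => ?_⟩
    have hsu : s < u := hs.trans_lt (ENNReal.coe_lt_coe.mp (not_le.mp hc))
    rcases le_total s t with h | h
    · refine le_trans ?_ (hn s h)
      rw [ENNReal.inv_le_inv]
      exact_mod_cast Nat.le_succ _
    · exact (hsub ⟨h, hsu⟩ : ((n + 1 : ℕ) + 1 : ℝ≥0∞)⁻¹ < _).le

/-- By right-continuity it suffices to look at countably many times, so the event belongs to
`ℱ_t`. -/
theorem measurableSet_staysInside (t : ℝ≥0) :
    MeasurableSet[natFiltration d t] (staysInside D t) := by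
  obtain ⟨Q, hQc, hQd⟩ := TopologicalSpace.exists_countable_dense ℝ≥0
  have heq : staysInside D t = ⋃ n : ℕ, ⋂ q ∈ Q,
      {ω : CadlagPath d | ((n : ℝ≥0∞) + 1)⁻¹ ≤ Metric.infEDist (ω (min q t)) Dᶜ} := by
    ext ω
    simp only [staysInside, mem_ofPred_eq, mem_iUnion, mem_iInter]
    refine exists_congr fun n => ⟨fun h q _ => h _ (min_le_right _ _), fun h s hs => ?_⟩
    have hcl : IsClosed {x : Euc d | ((n : ℝ≥0∞) + 1)⁻¹ ≤ Metric.infEDist x Dᶜ} :=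
      isClosed_le continuous_const Metric.continuous_infEDist
    have hmin : Tendsto (fun q => min q t) (𝓝[Ici s ∩ Q] s) (𝓝[≥] s) := by
      refine tendsto_nhdsWithin_iff.mpr ⟨?_, ?_⟩
      · have hc : Continuous fun q : ℝ≥0 => min q t := by fun_prop
        have := hc.tendsto s
        rw [min_eq_left hs] at this
        exact this.mono_left nhdsWithin_le_nhds
      · filter_upwards [self_mem_nhdsWithin] with q hq
        exact le_min hq.1 hs
    have hne : (𝓝[Ici s ∩ Q] s).NeBot := by
      have h1 : s ∈ closure (Ioi s ∩ Q) := by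
        have h2 : s ∈ closure (Ioi s) := by rw [closure_Ioi]; exact self_mem_Ici
        exact closure_minimal (hQd.open_subset_closure_inter isOpen_Ioi) isClosed_closure h2
      exact mem_closure_iff_nhdsWithin_neBot.mp
        (closure_mono (inter_subset_inter_left _ Ioi_subset_Ici_self) h1)
    refine hcl.mem_of_tendsto ((ω.right_cont s).tendsto.comp hmin) ?_
    filter_upwards [self_mem_nhdsWithin] with q hq
    exact h q hq.2
  rw [heq]
  refine MeasurableSet.iUnion fun n => MeasurableSet.biInter hQc fun q _ => ?_
  exact measurableSet_le measurable_const
    (Metric.continuous_infEDist.measurable.comp (measurable_natFiltration_eval (min_le_right q t)))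

theorem measurable_contactTime : Measurable (contactTime D) := by
  refine measurable_of_Ioi fun a => ?_
  induction a with
  | top => simp
  | coe t =>
    have : contactTime D ⁻¹' Ioi (t : ℝ≥0∞) = staysInside D t := by
      ext ω
      exact lt_contactTime_iff
    rw [this]
    exact (natFiltration d).le t _ (measurableSet_staysInside t)

theorem contactTime_le_exitTime (ω : CadlagPath d) : contactTime D ω ≤ exitTime D ω := by
  refine le_iInf₂ fun t ht => ?_
  by_contra hc
  exact ht.2 (mem_of_mem_staysInside (lt_contactTime_iff.mp (not_le.mp hc)) le_rfl)

theorem exitTime_le {ω : CadlagPath d} {t : ℝ≥0} (h0 : 0 < t) (ht : ω t ∉ D) :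
    exitTime D ω ≤ t :=
  iInf₂_le t ⟨h0, ht⟩

theorem mem_of_lt_exitTime {ω : CadlagPath d} (h0 : ω 0 ∈ D) {t : ℝ≥0}
    (ht : (t : ℝ≥0∞) < exitTime D ω) : ω t ∈ D := by
  rcases eq_or_lt_of_le (zero_le (a := t)) with h | h
  · exact h ▸ h0
  · by_contra hc
    exact absurd ht (not_lt.mpr (exitTime_le h hc))

end CadlagPath

/-! ### The integro-differential operator on `C_b²` -/

section Operator

variable {d : ℕ}

/-- A Lévy kernel is `s`-finite: it is the sum of its restrictions to the disjointed sets
`{1 / (n + 1) ≤ ‖y‖}`, which are finite kernels and exhaust the complement of `0`. -/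
theorem LevyKernelCond.isSFiniteKernel {N : Kernel (Euc d) (Euc d)} (hN : LevyKernelCond N) :
    IsSFiniteKernel N := by
  let B : ℕ → Set (Euc d) := fun n => {y | 1 / ((n : ℝ) + 1) ≤ ‖y‖}
  have hB : ∀ n, MeasurableSet (B n) := fun n => measurableSet_le measurable_const measurable_norm
  have hDm : ∀ n, MeasurableSet (disjointed B n) := fun n => MeasurableSet.disjointed hB n
  have hfin : ∀ n, IsFiniteKernel (N.restrict (hDm n)) := by
    intro n
    obtain ⟨C, hC⟩ := hN.bounded
    have hpos : 0 < min 1 ((1 / ((n : ℝ) + 1)) ^ 2) := by positivity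
    refine ⟨C / ENNReal.ofReal (min 1 ((1 / ((n : ℝ) + 1)) ^ 2)),
      ENNReal.div_lt_top ENNReal.coe_ne_top (ENNReal.ofReal_pos.mpr hpos).ne', fun x => ?_⟩
    rw [Kernel.restrict_apply, Measure.restrict_apply_univ]
    have hsub : disjointed B n ⊆ {y | ENNReal.ofReal (min 1 ((1 / ((n : ℝ) + 1)) ^ 2)) ≤
        ENNReal.ofReal (min 1 (‖y‖ ^ 2))} := by
      intro y hy
      have hy' : 1 / ((n : ℝ) + 1) ≤ ‖y‖ := disjointed_subset B n hy
      exact ENNReal.ofReal_le_ofReal (min_le_min_left _ (by gcongr))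
    refine (measure_mono hsub).trans ((meas_ge_le_lintegral_div (by fun_prop)
      (ENNReal.ofReal_pos.mpr hpos).ne' ENNReal.ofReal_ne_top).trans ?_)
    gcongr
    exact hC x
  have hsum : N = Kernel.sum fun n => N.restrict (hDm n) := by
    ext x s hs
    have hU : ⋃ n, disjointed B n = {0}ᶜ := by
      rw [iUnion_disjointed]
      ext y
      simp only [mem_iUnion, mem_compl_iff, mem_singleton_iff]
      constructor
      · rintro ⟨n, hn⟩ rfl
        have h1 : 1 / ((n : ℝ) + 1) ≤ ‖(0 : Euc d)‖ := hn
        have : 0 < 1 / ((n : ℝ) + 1) := by positivity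
        rw [norm_zero] at h1
        linarith
      · intro hy
        obtain ⟨n, hn⟩ := exists_nat_one_div_lt (norm_pos_iff.mpr hy)
        exact ⟨n, hn.le⟩
    rw [Kernel.sum_apply, Measure.sum_apply _ hs]
    simp_rw [Kernel.restrict_apply, Measure.restrict_apply hs]
    rw [← measure_iUnion (fun i j hij => ((disjoint_disjointed B hij).inter_left' s).inter_right' s)
      (fun n => hs.inter (hDm n)), ← inter_iUnion, hU]
    refine (measure_inter_conull' ?_).symm
    refine measure_mono_null (fun y hy => ?_) (hN.zero_singleton x)
    simpa using hy.2
  rw [hsum]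
  exact Kernel.isSFiniteKernel_sum (hκs := fun n => inferInstance)

theorem measurable_integroDiffOp {Q : Euc d → Matrix (Fin d) (Fin d) ℝ} {b : Euc d → Euc d}
    {N : Kernel (Euc d) (Euc d)} (hQb : LocalCoeffCond Q b) (hN : LevyKernelCond N)
    {f : Euc d → ℝ} (hf : IsCb2 f) : Measurable (integroDiffOp Q b N f) := by
  have := hN.isSFiniteKernel
  have hf2 : Continuous (iteratedFDeriv ℝ 2 f) := hf.1.continuous_iteratedFDeriv le_rfl
  have hf1 : Continuous (fderiv ℝ f) := hf.1.continuous_fderiv (by norm_num)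
  have hf0 : Continuous f := hf.1.continuous
  have happ : Continuous fun p : Euc d × Euc d => fderiv ℝ f p.1 p.2 :=
    (hf1.comp continuous_fst).clm_apply continuous_snd
  unfold integroDiffOp
  refine Measurable.add (Measurable.add (Measurable.const_mul ?_ _) ?_) ?_
  · refine Finset.measurable_sum _ fun i _ => Finset.measurable_sum _ fun j _ => ?_
    refine (hQb.measurable_Q i j).mul (Continuous.measurable ?_)
    exact (ContinuousMultilinearMap.apply ℝ (fun _ : Fin 2 => Euc d) ℝ
      ![EuclideanSpace.single i 1, EuclideanSpace.single j 1]).continuous.comp hf2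
  · exact happ.measurable.comp (measurable_id.prodMk hQb.measurable_b)
  · refine StronglyMeasurable.measurable (StronglyMeasurable.integral_kernel_prod_right
      (f := fun x y => f (x + y) - f x - fderiv ℝ f x y / (1 + ‖y‖ ^ 2)) ?_)
    refine Continuous.stronglyMeasurable ?_
    refine Continuous.sub (by fun_prop) (happ.div (by fun_prop) fun p => ?_)
    positivity

/-- Second order Taylor estimate for the integrand of the non-local part. -/
theorem abs_levyIntegrand_le {f : Euc d → ℝ} (hf : ContDiff ℝ 2 f) {C : ℝ}
    (hC : ∀ x, |f x| ≤ C ∧ ‖fderiv ℝ f x‖ ≤ C ∧ ‖iteratedFDeriv ℝ 2 f x‖ ≤ C) (x y : Euc d) :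
    |f (x + y) - f x - fderiv ℝ f x y / (1 + ‖y‖ ^ 2)| ≤ 3 * C * min 1 (‖y‖ ^ 2) := by
  have hC0 : 0 ≤ C := (abs_nonneg _).trans (hC x).1
  have hL : |fderiv ℝ f x y| ≤ C * ‖y‖ :=
    ((fderiv ℝ f x).le_opNorm y).trans (by gcongr; exact (hC x).2.1)
  have hpos : 0 < 1 + ‖y‖ ^ 2 := by positivity
  rcases le_or_gt ‖y‖ 1 with hy | hy
  · have h2 : ∀ z, ‖fderiv ℝ (fderiv ℝ f) z‖ ≤ C := by
      intro z
      rw [← norm_iteratedFDeriv_one, norm_iteratedFDeriv_fderiv]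
      exact (hC z).2.2
    have hd1 : ContDiff ℝ 1 (fderiv ℝ f) := hf.fderiv_right (by norm_num)
    have hlip : ∀ z ∈ Metric.closedBall x ‖y‖, ‖fderiv ℝ f z - fderiv ℝ f x‖ ≤ C * ‖y‖ := by
      intro z hz
      refine (convex_univ.norm_image_sub_le_of_norm_fderiv_le
        (fun w _ => (hd1.differentiable (by norm_num)).differentiableAt) (fun w _ => h2 w)
        (mem_univ x) (mem_univ z)).trans ?_
      gcongr
      exact mem_closedBall_iff_norm.mp hz
    have hT : |f (x + y) - f x - fderiv ℝ f x y| ≤ C * ‖y‖ * ‖y‖ := by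
      have := (convex_closedBall x ‖y‖).norm_image_sub_le_of_norm_fderiv_le'
        (fun w _ => (hf.differentiable (by norm_num)).differentiableAt) hlip
        (Metric.mem_closedBall_self (norm_nonneg y)) (y := x + y) (by simp)
      simpa using this
    have hR : |fderiv ℝ f x y - fderiv ℝ f x y / (1 + ‖y‖ ^ 2)| ≤ C * ‖y‖ ^ 2 := by
      have : fderiv ℝ f x y - fderiv ℝ f x y / (1 + ‖y‖ ^ 2) =
          fderiv ℝ f x y * (‖y‖ ^ 2 / (1 + ‖y‖ ^ 2)) := by field_simp; ring
      rw [this, abs_mul, abs_of_nonneg (by positivity : 0 ≤ ‖y‖ ^ 2 / (1 + ‖y‖ ^ 2))]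
      refine mul_le_mul (hL.trans (mul_le_of_le_one_right hC0 hy)) ?_ (by positivity) hC0
      exact div_le_self (by positivity) (by nlinarith [sq_nonneg ‖y‖])
    have hmin : min 1 (‖y‖ ^ 2) = ‖y‖ ^ 2 := min_eq_right (pow_le_one₀ (norm_nonneg y) hy)
    have hsplit : f (x + y) - f x - fderiv ℝ f x y / (1 + ‖y‖ ^ 2) =
        (f (x + y) - f x - fderiv ℝ f x y) +
          (fderiv ℝ f x y - fderiv ℝ f x y / (1 + ‖y‖ ^ 2)) := by ring
    rw [hmin, hsplit]
    refine (abs_add_le _ _).trans ?_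
    have : 0 ≤ C * ‖y‖ ^ 2 := by positivity
    nlinarith
  · have hmin : min 1 (‖y‖ ^ 2) = 1 := min_eq_left (one_le_pow₀ hy.le)
    have hR : |fderiv ℝ f x y / (1 + ‖y‖ ^ 2)| ≤ C := by
      rw [abs_div, abs_of_pos hpos, div_le_iff₀ hpos]
      refine hL.trans (mul_le_mul_of_nonneg_left ?_ hC0)
      nlinarith
    rw [hmin]
    have h1 := (hC (x + y)).1
    have h2 := (hC x).1
    rw [abs_le] at *
    constructor <;> linarith

theorem exists_bound_integroDiffOp {Q : Euc d → Matrix (Fin d) (Fin d) ℝ} {b : Euc d → Euc d}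
    {N : Kernel (Euc d) (Euc d)} (hQb : LocalCoeffCond Q b) (hN : LevyKernelCond N)
    {f : Euc d → ℝ} (hf : IsCb2 f) : ∃ K : ℝ, ∀ x, |integroDiffOp Q b N f x| ≤ K := by
  obtain ⟨hf2, C, hC⟩ := hf
  obtain ⟨CQ, hCQ⟩ := hQb.bounded_Q
  obtain ⟨Cb, hCb⟩ := hQb.bounded_b
  obtain ⟨CN, hCN⟩ := hN.bounded
  have hC0 : 0 ≤ C := (abs_nonneg _).trans (hC 0).1
  refine ⟨1 / 2 * (∑ _i : Fin d, ∑ _j : Fin d, CQ * C) + C * Cb + 3 * C * CN, fun x => ?_⟩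
  unfold integroDiffOp
  refine (abs_add_le _ _).trans (add_le_add ((abs_add_le _ _).trans (add_le_add ?_ ?_)) ?_)
  · rw [abs_mul, abs_of_pos (by norm_num : (0 : ℝ) < 1 / 2)]
    refine mul_le_mul_of_nonneg_left ?_ (by norm_num)
    refine (Finset.abs_sum_le_sum_abs _ _).trans (Finset.sum_le_sum fun i _ => ?_)
    refine (Finset.abs_sum_le_sum_abs _ _).trans (Finset.sum_le_sum fun j _ => ?_)
    rw [abs_mul]
    refine mul_le_mul (hCQ x i j) ?_ (abs_nonneg _) ((abs_nonneg _).trans (hCQ x i j))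
    refine (ContinuousMultilinearMap.le_opNorm (iteratedFDeriv ℝ 2 f x) _).trans ?_
    simpa [Fin.prod_univ_two] using (hC x).2.2
  · refine ((fderiv ℝ f x).le_opNorm _).trans ?_
    exact mul_le_mul (hC x).2.1 (hCb x) (norm_nonneg _) hC0
  · rw [← Real.norm_eq_abs]
    refine (norm_integral_le_lintegral_norm _).trans ?_
    have hle : ∫⁻ y, ENNReal.ofReal ‖f (x + y) - f x - fderiv ℝ f x y / (1 + ‖y‖ ^ 2)‖ ∂(N x) ≤
        ENNReal.ofReal (3 * C * CN) := by
      calc _ ≤ ∫⁻ y, ENNReal.ofReal (3 * C) * ENNReal.ofReal (min 1 (‖y‖ ^ 2)) ∂(N x) := by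
            refine lintegral_mono fun y => ?_
            rw [← ENNReal.ofReal_mul (by positivity)]
            exact ENNReal.ofReal_le_ofReal (abs_levyIntegrand_le hf2 hC x y)
        _ = ENNReal.ofReal (3 * C) * ∫⁻ y, ENNReal.ofReal (min 1 (‖y‖ ^ 2)) ∂(N x) :=
            lintegral_const_mul _ (by fun_prop)
        _ ≤ ENNReal.ofReal (3 * C) * CN := by gcongr; exact hCN x
        _ = _ := by
            rw [ENNReal.ofReal_mul (p := 3 * C) (by positivity), ENNReal.ofReal_coe_nnreal]
    exact ENNReal.toReal_le_of_le_ofReal (by positivity) hle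

/-- Where `f` vanishes locally, only the jump part of `A f` survives. -/
theorem integroDiffOp_eq_of_eventuallyEq_zero {Q : Euc d → Matrix (Fin d) (Fin d) ℝ}
    {b : Euc d → Euc d} {N : Kernel (Euc d) (Euc d)} {f : Euc d → ℝ} {x : Euc d}
    (hf : f =ᶠ[𝓝 x] 0) : integroDiffOp Q b N f x = ∫ y, f (x + y) ∂(N x) := by
  have h1 : fderiv ℝ f x = 0 := by
    rw [hf.fderiv_eq]
    simp
  have h2 : iteratedFDeriv ℝ 2 f x = 0 := by
    rw [(hf.iteratedFDeriv ℝ 2).eq_of_nhds]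
    simp
  simp [integroDiffOp, h1, h2, hf.eq_of_nhds]

theorem isCb2_of_hasCompactSupport {f : Euc d → ℝ} (hf : ContDiff ℝ 2 f)
    (hs : HasCompactSupport f) : IsCb2 f := by
  obtain ⟨C0, h0⟩ := hf.continuous.bounded_above_of_compact_support hs
  obtain ⟨C1, h1⟩ := (hf.continuous_fderiv (by norm_num)).bounded_above_of_compact_support
    (hs.fderiv ℝ)
  obtain ⟨C2, h2⟩ := (hf.continuous_iteratedFDeriv le_rfl).bounded_above_of_compact_support
    (hs.iteratedFDeriv (𝕜 := ℝ) 2)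
  refine ⟨hf, max C0 (max C1 C2), fun x => ⟨?_, ?_, ?_⟩⟩
  · exact (h0 x).trans (le_max_left _ _)
  · exact (h1 x).trans ((le_max_left _ _).trans (le_max_right _ _))
  · exact (h2 x).trans ((le_max_right _ _).trans (le_max_right _ _))

end Operator

/-! ### Jumps of solutions of the martingale problem -/

section Jumps

variable {d : ℕ}

/-- Martingale increments are orthogonal to bounded weights known at the left endpoint. -/
theorem integral_mul_martingale_eq {Ω : Type*} {mΩ : MeasurableSpace Ω} {μ : Measure Ω}
    [IsFiniteMeasure μ] {ℱ : Filtration ℝ≥0 mΩ} {M : ℝ≥0 → Ω → ℝ} (hM : Martingale M ℱ μ)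
    {s t : ℝ≥0} (hst : s ≤ t) {w : Ω → ℝ} (hw : Measurable[ℱ s] w) {C : ℝ}
    (hC : ∀ ω, |w ω| ≤ C) : ∫ ω, w ω * M t ω ∂μ = ∫ ω, w ω * M s ω ∂μ := by
  have hint : ∀ r, Integrable (fun ω => w ω * M r ω) μ := fun r =>
    (hM.integrable r).bdd_mul (hw.mono (ℱ.le s) le_rfl).aestronglyMeasurable
      (Eventually.of_forall hC)
  calc ∫ ω, w ω * M t ω ∂μ = ∫ ω, (μ[w * M t | ℱ s]) ω ∂μ := (integral_condExp (ℱ.le s)).symm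
    _ = ∫ ω, w ω * M s ω ∂μ := by
        refine integral_congr_ae ?_
        filter_upwards [condExp_mul_of_stronglyMeasurable_left hw.stronglyMeasurable (hint t)
          (hM.integrable t), hM.condExp_ae_eq hst] with ω h1 h2
        rw [h1, Pi.mul_apply, h2]

/-- Evaluation of the canonical process at real times, jointly measurable. -/
theorem measurable_eval_toNNReal :
    Measurable fun p : ℝ × CadlagPath d => p.2 p.1.toNNReal :=
  measurable_uncurry.comp (measurable_fst.real_toNNReal.prodMk measurable_snd)

theorem intervalIntegrable_path {h : Euc d → ℝ} (hm : Measurable h) {K : ℝ}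
    (hK : ∀ x, |h x| ≤ K) (ω : CadlagPath d) (s t : ℝ) :
    IntervalIntegrable (fun r : ℝ => h (ω r.toNNReal)) volume s t := by
  rw [intervalIntegrable_iff]
  exact Measure.integrableOn_of_bounded (M := K) (by simp)
    (hm.comp (measurable_eval_toNNReal.comp measurable_prodMk_right)).aestronglyMeasurable
    (Eventually.of_forall fun r => hK _)

/-- The increments of `f(X)` and of `∫ Af(X_r) dr` agree when tested against bounded weights known
at the left endpoint. -/
theorem integral_mul_increment {Q : Euc d → Matrix (Fin d) (Fin d) ℝ} {b : Euc d → Euc d}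
    {N : Kernel (Euc d) (Euc d)} {P : Measure (CadlagPath d)} [IsProbabilityMeasure P]
    (hQb : LocalCoeffCond Q b) (hN : LevyKernelCond N)
    {f : Euc d → ℝ} (hf : IsCb2 f) (hM : Martingale (mpProcess Q b N f) (natFiltration d) P)
    {s t : ℝ≥0} (hst : s ≤ t) {w : CadlagPath d → ℝ} (hw : Measurable[natFiltration d s] w)
    (hC : ∀ ω, |w ω| ≤ 1) :
    ∫ ω, w ω * (f (ω t) - f (ω s)) ∂P =
      ∫ ω, w ω * (∫ r in (s : ℝ)..t, integroDiffOp Q b N f (ω r.toNNReal)) ∂P := by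
  obtain ⟨K, hK⟩ := exists_bound_integroDiffOp hQb hN hf
  have hm := measurable_integroDiffOp hQb hN hf
  have hwm : Measurable w := hw.mono ((natFiltration d).le s) le_rfl
  have hf0 : Measurable f := hf.1.continuous.measurable
  have key : ∀ ω : CadlagPath d, w ω * mpProcess Q b N f t ω - w ω * mpProcess Q b N f s ω =
      w ω * (f (ω t) - f (ω s)) -
        w ω * (∫ r in (s : ℝ)..t, integroDiffOp Q b N f (ω r.toNNReal)) := by
    intro ω
    have hadd := intervalIntegral.integral_add_adjacent_intervals
      (intervalIntegrable_path hm hK ω 0 s) (intervalIntegrable_path hm hK ω s t)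
    simp only [mpProcess]
    rw [← hadd]
    ring
  have hint : ∀ r, Integrable (fun ω => w ω * mpProcess Q b N f r ω) P := fun r =>
    (hM.integrable r).bdd_mul hwm.aestronglyMeasurable (Eventually.of_forall hC)
  have hint1 : Integrable (fun ω : CadlagPath d => w ω * (f (ω t) - f (ω s))) P := by
    obtain ⟨C, hfC⟩ := hf.2
    refine Integrable.bdd_mul (c := 1) ?_ hwm.aestronglyMeasurable (Eventually.of_forall hC)
    exact (Integrable.of_bound (hf0.comp (measurable_eval t)).aestronglyMeasurable C
      (Eventually.of_forall fun ω => (hfC _).1)).sub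
      (Integrable.of_bound (hf0.comp (measurable_eval s)).aestronglyMeasurable C
      (Eventually.of_forall fun ω => (hfC _).1))
  have hint2 : Integrable (fun ω : CadlagPath d =>
      w ω * (∫ r in (s : ℝ)..t, integroDiffOp Q b N f (ω r.toNNReal))) P := by
    have := hint1.sub ((hint t).sub (hint s))
    refine this.congr (Eventually.of_forall fun ω => ?_)
    simp only [Pi.sub_apply]
    rw [key ω]
    ring
  have h0 : ∫ ω, (w ω * mpProcess Q b N f t ω - w ω * mpProcess Q b N f s ω) ∂P = 0 := by
    rw [integral_sub (hint t) (hint s), integral_mul_martingale_eq hM hst hw hC, sub_self]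
  rw [integral_congr_ae (Eventually.of_forall key), integral_sub hint1 hint2] at h0
  exact sub_eq_zero.mp h0

/-- The last point of the grid `ℕ / (n + 1)` strictly before `r > 0`. -/
def gridBefore (n : ℕ) (r : ℝ≥0) : ℝ≥0 :=
  ((⌈r * (n + 1)⌉₊ - 1 : ℕ) : ℝ≥0) / (n + 1)

theorem measurable_gridBefore (n : ℕ) : Measurable (gridBefore n) := by
  have h : Measurable fun k : ℕ => ((k - 1 : ℕ) : ℝ≥0) / ((n : ℝ≥0) + 1) := measurable_from_nat
  exact h.comp (Nat.measurable_ceil.comp (measurable_id.mul_const _))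

theorem gridBefore_lt (n : ℕ) {r : ℝ≥0} (hr : 0 < r) : gridBefore n r < r := by
  have hpos : 0 < r * (n + 1) := by positivity
  rw [gridBefore, div_lt_iff₀ (by positivity)]
  refine Nat.lt_ceil.mp ?_
  have := Nat.ceil_pos.mpr hpos
  omega

theorem le_gridBefore_add (n : ℕ) (r : ℝ≥0) : r ≤ gridBefore n r + 1 / (n + 1) := by
  rw [gridBefore, ← add_div, le_div_iff₀ (by positivity)]
  refine (Nat.le_ceil _).trans ?_
  have : ⌈r * (n + 1)⌉₊ ≤ (⌈r * (n + 1)⌉₊ - 1) + 1 := by omega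
  exact_mod_cast this

theorem gridBefore_eq (n i : ℕ) {r : ℝ≥0} (h1 : (i : ℝ≥0) / (n + 1) < r)
    (h2 : r ≤ ((i + 1 : ℕ) : ℝ≥0) / (n + 1)) : gridBefore n r = (i : ℝ≥0) / (n + 1) := by
  rw [div_lt_iff₀ (by positivity)] at h1
  rw [le_div_iff₀ (by positivity)] at h2
  have : ⌈r * (n + 1)⌉₊ = i + 1 := le_antisymm (Nat.ceil_le.mpr h2) (Nat.lt_ceil.mpr h1)
  rw [gridBefore, this, Nat.add_sub_cancel]

theorem tendsto_gridBefore {r : ℝ≥0} (hr : 0 < r) :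
    Tendsto (fun n => gridBefore n r) atTop (𝓝[<] r) := by
  refine tendsto_nhdsWithin_iff.mpr ⟨?_, .of_forall fun n => gridBefore_lt n hr⟩
  have h1 : Tendsto (fun n : ℕ => 1 / ((n : ℝ≥0) + 1)) atTop (𝓝 0) :=
    tendsto_one_div_add_atTop_nhds_zero_nat (𝕜 := ℝ≥0)
  have h2 : Tendsto (fun n : ℕ => r - 1 / ((n : ℝ≥0) + 1)) atTop (𝓝 r) := by
    simpa using (tendsto_const_nhds (x := r)).sub h1
  exact tendsto_of_tendsto_of_tendsto_of_le_of_le h2 tendsto_const_nhds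
    (fun n => tsub_le_iff_right.mpr (le_gridBefore_add n r)) fun n => (gridBefore_lt n hr).le

theorem tendsto_gridBefore_add {r : ℝ≥0} (hr : 0 < r) :
    Tendsto (fun n : ℕ => gridBefore n r + 1 / (n + 1)) atTop (𝓝[≥] r) := by
  refine tendsto_nhdsWithin_iff.mpr ⟨?_, .of_forall fun n => le_gridBefore_add n r⟩
  simpa using (tendsto_nhdsWithin_iff.mp (tendsto_gridBefore hr)).1.add
    (tendsto_one_div_add_atTop_nhds_zero_nat (𝕜 := ℝ≥0))

/-- The weight `g(X_t)` on the event that the path has stayed inside `D` up to time `t`. -/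
def stayWeight (D : Set (Euc d)) (g : Euc d → ℝ) (t : ℝ≥0) (ω : CadlagPath d) : ℝ :=
  (staysInside D t).indicator (fun ω => g (ω t)) ω

theorem measurable_stayWeight (D : Set (Euc d)) {g : Euc d → ℝ} (hg : Measurable g) (t : ℝ≥0) :
    Measurable[natFiltration d t] (stayWeight D g t) :=
  Measurable.indicator (m := natFiltration d t) (hg.comp (measurable_natFiltration_eval le_rfl))
    (measurableSet_staysInside t)

theorem measurable_stayWeight_uncurry (D : Set (Euc d)) {g : Euc d → ℝ} (hg : Measurable g) :
    Measurable fun p : ℝ≥0 × CadlagPath d => stayWeight D g p.1 p.2 := by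
  have heq : (fun p : ℝ≥0 × CadlagPath d => stayWeight D g p.1 p.2) =
      {p : ℝ≥0 × CadlagPath d | (p.1 : ℝ≥0∞) < contactTime D p.2}.indicator
        fun p => g (p.2 p.1) := by
    ext p
    by_cases h : p.2 ∈ staysInside D p.1
    · rw [stayWeight, indicator_of_mem h, indicator_of_mem]
      exact lt_contactTime_iff.mpr h
    · rw [stayWeight, indicator_of_notMem h, indicator_of_notMem]
      exact fun hc => h (lt_contactTime_iff.mp hc)
  rw [heq]
  exact (hg.comp measurable_uncurry).indicator
    (measurableSet_lt (by fun_prop) (measurable_contactTime.comp measurable_snd))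

theorem abs_stayWeight_le (D : Set (Euc d)) {g : Euc d → ℝ} (hg : ∀ x, g x ∈ Icc (0 : ℝ) 1)
    (t : ℝ≥0) (ω : CadlagPath d) : |stayWeight D g t ω| ≤ 1 := by
  rw [stayWeight]
  by_cases h : ω ∈ staysInside D t
  · rw [indicator_of_mem h, abs_of_nonneg (hg _).1]
    exact (hg _).2
  · simp [indicator_of_notMem h]

theorem stayWeight_nonneg (D : Set (Euc d)) {g : Euc d → ℝ} (hg : ∀ x, g x ∈ Icc (0 : ℝ) 1)
    (t : ℝ≥0) (ω : CadlagPath d) : 0 ≤ stayWeight D g t ω :=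
  indicator_nonneg (fun _ _ => (hg _).1) _

/-- Discretization, with mesh `1 / (n + 1)`, of the sum of `g(X_{s-}) f(X_s)` over the jump times
`s ≤ T` before the contact time with `Dᶜ`. -/
def jumpSum (D : Set (Euc d)) (g f : Euc d → ℝ) (T n : ℕ) (ω : CadlagPath d) : ℝ :=
  ∑ i ∈ Finset.range (T * (n + 1)), stayWeight D g ((i : ℝ≥0) / (n + 1)) ω *
    f (ω (((i + 1 : ℕ) : ℝ≥0) / (n + 1)))

theorem measurable_jumpSum (D : Set (Euc d)) {g f : Euc d → ℝ} (hg : Measurable g)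
    (hf : Measurable f) (T n : ℕ) : Measurable (jumpSum D g f T n) := by
  refine Finset.measurable_sum _ fun i _ => Measurable.mul ?_ (hf.comp (measurable_eval _))
  exact (measurable_stayWeight D hg _).mono ((natFiltration d).le _) le_rfl

theorem integrable_jumpSum_term {D : Set (Euc d)} {g f : Euc d → ℝ} (hg : Measurable g)
    (hg1 : ∀ x, g x ∈ Icc (0 : ℝ) 1) (hf : IsCb2 f) {P : Measure (CadlagPath d)}
    [IsProbabilityMeasure P] (s t : ℝ≥0) :
    Integrable (fun ω : CadlagPath d => stayWeight D g s ω * f (ω t)) P := by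
  obtain ⟨C, hC⟩ := hf.2
  refine Integrable.bdd_mul (c := 1) ?_
    ((measurable_stayWeight D hg _).mono ((natFiltration d).le _) le_rfl).aestronglyMeasurable
    (Eventually.of_forall (abs_stayWeight_le D hg1 s))
  exact Integrable.of_bound (hf.1.continuous.measurable.comp
    (measurable_eval t)).aestronglyMeasurable C (Eventually.of_forall fun ω => (hC _).1)

/-- When `g` lives where `f` vanishes, the martingale problem turns the expected discretized jump
sum into a time integral of `g(X) Af(X)`, with `g(X)` sampled at the preceding grid point. -/
theorem integral_jumpSum {Q : Euc d → Matrix (Fin d) (Fin d) ℝ} {b : Euc d → Euc d}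
    {N : Kernel (Euc d) (Euc d)} {P : Measure (CadlagPath d)} [IsProbabilityMeasure P]
    (hQb : LocalCoeffCond Q b) (hN : LevyKernelCond N) (D : Set (Euc d))
    {f : Euc d → ℝ} (hf : IsCb2 f) (hM : Martingale (mpProcess Q b N f) (natFiltration d) P)
    {g : Euc d → ℝ} (hg : Measurable g) (hg1 : ∀ x, g x ∈ Icc (0 : ℝ) 1)
    (hgf : ∀ x, g x * f x = 0) (T n : ℕ) :
    ∫ ω, jumpSum D g f T n ω ∂P =
      ∫ ω, (∫ r in Ioc (0 : ℝ) T, stayWeight D g (gridBefore n r.toNNReal) ω *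
        integroDiffOp Q b N f (ω r.toNNReal)) ∂P := by
  obtain ⟨K, hK⟩ := exists_bound_integroDiffOp hQb hN hf
  have hm := measurable_integroDiffOp hQb hN hf
  let a : ℕ → ℝ≥0 := fun i => (i : ℝ≥0) / (n + 1)
  have ha : ∀ i, a i ≤ a (i + 1) := fun i => by
    change _ / _ ≤ _ / _
    gcongr
    exact_mod_cast Nat.le_succ i
  have hzero : ∀ s ω, stayWeight D g s ω * f (ω s) = 0 := by
    intro s ω
    by_cases h : ω ∈ staysInside D s
    · rw [stayWeight, indicator_of_mem h, hgf]
    · rw [stayWeight, indicator_of_notMem h, zero_mul]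
  have hpath : ∀ ω : CadlagPath d, (∫ r in Ioc (0 : ℝ) T,
      stayWeight D g (gridBefore n r.toNNReal) ω * integroDiffOp Q b N f (ω r.toNNReal)) =
      ∑ i ∈ Finset.range (T * (n + 1)), stayWeight D g (a i) ω *
        ∫ r in (a i : ℝ)..a (i + 1), integroDiffOp Q b N f (ω r.toNNReal) := by
    intro ω
    have hint : ∀ s t : ℝ, IntervalIntegrable (fun r : ℝ =>
        stayWeight D g (gridBefore n r.toNNReal) ω * integroDiffOp Q b N f (ω r.toNNReal))
        volume s t := by
      intro s t
      rw [intervalIntegrable_iff]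
      refine Integrable.bdd_mul (c := 1)
        (intervalIntegrable_iff.mp (intervalIntegrable_path hm hK ω s t)) ?_ ?_
      · exact ((measurable_stayWeight_uncurry D hg).comp
          (((measurable_gridBefore n).comp measurable_real_toNNReal).prodMk
            measurable_const)).aestronglyMeasurable
      · exact Eventually.of_forall fun r => abs_stayWeight_le D hg1 _ ω
    have hT : ((a (T * (n + 1)) : ℝ≥0) : ℝ) = T := by
      simp only [a]
      push_cast
      field_simp
    have h0 : ((a 0 : ℝ≥0) : ℝ) = 0 := by simp [a]
    rw [← intervalIntegral.integral_of_le (Nat.cast_nonneg T), ← hT]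
    nth_rewrite 1 [← h0]
    rw [← intervalIntegral.sum_integral_adjacent_intervals (a := fun i => ((a i : ℝ≥0) : ℝ))
      fun k _ => hint _ _]
    refine Finset.sum_congr rfl fun i _ => ?_
    rw [← intervalIntegral.integral_const_mul]
    refine intervalIntegral.integral_congr_ae (Eventually.of_forall fun r hr => ?_)
    rw [uIoc_of_le (NNReal.coe_le_coe.mpr (ha i))] at hr
    have h1 : a i < r.toNNReal := Real.lt_toNNReal_iff_coe_lt.mpr hr.1
    have h2 : r.toNNReal ≤ a (i + 1) := Real.toNNReal_le_iff_le_coe.mpr hr.2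
    rw [gridBefore_eq n i h1 h2]
  simp_rw [hpath, jumpSum]
  have hint2 : ∀ i, Integrable (fun ω : CadlagPath d => stayWeight D g (a i) ω *
      ∫ r in (a i : ℝ)..a (i + 1), integroDiffOp Q b N f (ω r.toNNReal)) P := by
    intro i
    have hmeas : StronglyMeasurable fun ω : CadlagPath d =>
        ∫ r in (a i : ℝ)..a (i + 1), integroDiffOp Q b N f (ω r.toNNReal) := by
      simp_rw [intervalIntegral.integral_of_le (NNReal.coe_le_coe.mpr (ha i))]
      exact StronglyMeasurable.integral_prod_right'
        (f := fun p : CadlagPath d × ℝ => integroDiffOp Q b N f (p.1 p.2.toNNReal))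
        (hm.comp (measurable_eval_toNNReal.comp measurable_swap)).stronglyMeasurable
    refine Integrable.bdd_mul (c := 1) ?_
      ((measurable_stayWeight D hg _).mono ((natFiltration d).le _) le_rfl).aestronglyMeasurable
      (Eventually.of_forall (abs_stayWeight_le D hg1 _))
    refine Integrable.of_bound hmeas.aestronglyMeasurable (K * |(a (i + 1) : ℝ) - a i|)
      (Eventually.of_forall fun ω => ?_)
    exact intervalIntegral.norm_integral_le_of_norm_le_const fun r _ => hK _
  rw [integral_finsetSum _ fun i _ => integrable_jumpSum_term hg hg1 hf _ _,
    integral_finsetSum _ fun i _ => hint2 i]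
  refine Finset.sum_congr rfl fun i _ => ?_
  rw [← integral_mul_increment hQb hN hf hM (ha i) (measurable_stayWeight D hg _)
    (abs_stayWeight_le D hg1 _)]
  refine integral_congr_ae (Eventually.of_forall fun ω => ?_)
  simp only [mul_sub, hzero, sub_zero, a]

/-- Occupation measure of the canonical process on the time interval `(0, T]`, up to the contact
time with `Dᶜ`: the law of `X_r` under `dr ⊗ P`. -/
def occupation (P : Measure (CadlagPath d)) (D : Set (Euc d)) (T : ℕ) : Measure (Euc d) :=
  Measure.map (fun p : ℝ × CadlagPath d => p.2 p.1.toNNReal)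
    (((volume.restrict (Ioc (0 : ℝ) T)).prod P).restrict
      {p | ENNReal.ofReal p.1 ≤ contactTime D p.2})

theorem measurableSet_le_contactTime (D : Set (Euc d)) :
    MeasurableSet {p : ℝ × CadlagPath d | ENNReal.ofReal p.1 ≤ contactTime D p.2} :=
  measurableSet_le (by fun_prop) (measurable_contactTime.comp measurable_snd)

instance instIsFiniteMeasureOccupation (P : Measure (CadlagPath d)) [IsProbabilityMeasure P] (D : Set (Euc d)) (T : ℕ) :
    IsFiniteMeasure (occupation P D T) := by
  unfold occupation
  infer_instance

theorem integral_occupation (P : Measure (CadlagPath d)) [IsProbabilityMeasure P]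
    (D : Set (Euc d)) (T : ℕ) {k : Euc d → ℝ} (hk : Measurable k) {K : ℝ}
    (hK : ∀ x, |k x| ≤ K) :
    ∫ x, k x ∂(occupation P D T) = ∫ ω, (∫ r in Ioc (0 : ℝ) T,
      {r : ℝ | ENNReal.ofReal r ≤ contactTime D ω}.indicator
        (fun r => k (ω r.toNNReal)) r) ∂P := by
  rw [occupation, integral_map measurable_eval_toNNReal.aemeasurable hk.aestronglyMeasurable,
    ← integral_indicator (measurableSet_le_contactTime D), integral_prod_symm]
  · rfl
  · refine Integrable.indicator ?_ (measurableSet_le_contactTime D)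
    exact Integrable.of_bound (hk.comp measurable_eval_toNNReal).aestronglyMeasurable K
      (Eventually.of_forall fun p => hK _)

/-- Before the contact time the path is inside `D`, so `Dᶜ` carries no occupation time. -/
theorem occupation_compl (P : Measure (CadlagPath d)) [IsProbabilityMeasure P]
    {D : Set (Euc d)} (hD : IsOpen D) (T : ℕ) : occupation P D T Dᶜ = 0 := by
  have hDm : MeasurableSet Dᶜ := hD.measurableSet.compl
  rw [occupation, Measure.map_apply measurable_eval_toNNReal hDm,
    Measure.restrict_apply (measurable_eval_toNNReal hDm), Measure.prod_apply_symm
    ((measurable_eval_toNNReal hDm).inter (measurableSet_le_contactTime D))]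
  refine lintegral_eq_zero_of_ae_eq_zero (Eventually.of_forall fun ω => ?_)
  have hsub : (fun r : ℝ => (r, ω)) ⁻¹' ((fun p : ℝ × CadlagPath d => p.2 p.1.toNNReal) ⁻¹' Dᶜ ∩
      {p | ENNReal.ofReal p.1 ≤ contactTime D p.2}) ⊆
      Iic 0 ∪ {(contactTime D ω).toReal} := by
    rintro r ⟨hr1, hr2⟩
    have hr2' : ENNReal.ofReal r ≤ contactTime D ω := hr2
    have hr1' : ω r.toNNReal ∉ D := hr1
    rcases le_or_gt r 0 with h0 | h0
    · exact Or.inl h0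
    · right
      have heq : ENNReal.ofReal r = contactTime D ω := by
        refine le_antisymm hr2' (not_lt.mp fun hlt => hr1' ?_)
        exact mem_of_mem_staysInside (lt_contactTime_iff.mp hlt) le_rfl
      rw [mem_singleton_iff, ← heq, ENNReal.toReal_ofReal h0.le]
  refine measure_mono_null hsub (measure_union_null ?_ ?_)
  · rw [Measure.restrict_apply measurableSet_Iic, Iic_inter_Ioc_of_le (by simp)]
    simp
  · exact measure_mono_null (subset_refl _) (by simp)

/-- As the mesh tends to zero, the expected discretized jump sum tends to the integral of `g Af`
over the occupation measure. -/
theorem tendsto_integral_jumpSum {Q : Euc d → Matrix (Fin d) (Fin d) ℝ} {b : Euc d → Euc d}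
    {N : Kernel (Euc d) (Euc d)} {P : Measure (CadlagPath d)} [IsProbabilityMeasure P]
    (hQb : LocalCoeffCond Q b) (hN : LevyKernelCond N) (D : Set (Euc d))
    {f : Euc d → ℝ} (hf : IsCb2 f) (hM : Martingale (mpProcess Q b N f) (natFiltration d) P)
    {g : Euc d → ℝ} (hg : Continuous g) (hg1 : ∀ x, g x ∈ Icc (0 : ℝ) 1)
    (hgf : ∀ x, g x * f x = 0) (T : ℕ) :
    Tendsto (fun n => ∫ ω, jumpSum D g f T n ω ∂P) atTop
      (𝓝 (∫ x, g x * integroDiffOp Q b N f x ∂(occupation P D T))) := by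
  obtain ⟨K, hK⟩ := exists_bound_integroDiffOp hQb hN hf
  have hm := measurable_integroDiffOp hQb hN hf
  have hgK : ∀ x, |g x * integroDiffOp Q b N f x| ≤ K := by
    intro x
    rw [abs_mul, abs_of_nonneg (hg1 x).1]
    exact (mul_le_of_le_one_left (abs_nonneg _) (hg1 x).2).trans (hK x)
  have hF : ∀ n, Measurable fun p : CadlagPath d × ℝ =>
      stayWeight D g (gridBefore n p.2.toNNReal) p.1 *
        integroDiffOp Q b N f (p.1 p.2.toNNReal) := by
    intro n
    refine Measurable.mul ?_ (hm.comp (measurable_eval_toNNReal.comp measurable_swap))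
    exact (measurable_stayWeight_uncurry D hg.measurable).comp
      (((measurable_gridBefore n).comp measurable_snd.real_toNNReal).prodMk measurable_fst)
  have hFb : ∀ n (ω : CadlagPath d) (r : ℝ), ‖stayWeight D g (gridBefore n r.toNNReal) ω *
      integroDiffOp Q b N f (ω r.toNNReal)‖ ≤ K := by
    intro n ω r
    rw [norm_mul]
    exact (mul_le_of_le_one_left (norm_nonneg _) (abs_stayWeight_le D hg1 _ _)).trans (hK _)
  simp_rw [integral_jumpSum hQb hN D hf hM hg.measurable hg1 hgf T]
  rw [integral_occupation P D T (k := fun x => g x * integroDiffOp Q b N f x)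
    (hg.measurable.mul hm) hgK]
  refine tendsto_integral_of_dominated_convergence (fun _ => K * T) (fun n => ?_)
    (integrable_const _) (fun n => Eventually.of_forall fun ω => ?_)
    (Eventually.of_forall fun ω => ?_)
  · exact (StronglyMeasurable.integral_prod_right' (hF n).stronglyMeasurable).aestronglyMeasurable
  · have := norm_setIntegral_le_of_norm_le_const (μ := volume) (s := Ioc (0 : ℝ) T) (by simp)
      fun r _ => hFb n ω r
    simpa using this
  · refine tendsto_integral_of_dominated_convergence (fun _ => K) (fun n => ?_)
      (integrable_const _) (fun n => Eventually.of_forall fun r => hFb n ω r) ?_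
    · exact ((hF n).comp measurable_prodMk_left).aestronglyMeasurable
    · have hcount : ∀ᵐ r : ℝ, r ∉ (fun s : ℝ≥0 => (s : ℝ)) ''
          {s : ℝ≥0 | ¬ Tendsto ω (𝓝[<] s) (𝓝 (ω s))} :=
        ((countable_jumps ω).image _).ae_notMem volume
      filter_upwards [ae_restrict_of_ae hcount, ae_restrict_mem measurableSet_Ioc] with r hr hr0
      have hpos : 0 < r.toNNReal := Real.toNNReal_pos.mpr hr0.1
      have hcont : Tendsto ω (𝓝[<] r.toNNReal) (𝓝 (ω r.toNNReal)) := by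
        by_contra hc
        exact hr ⟨r.toNNReal, hc, Real.coe_toNNReal r hr0.1.le⟩
      have hgrid := tendsto_gridBefore hpos
      by_cases hle : ENNReal.ofReal r ≤ contactTime D ω
      · rw [indicator_of_mem (s := {r : ℝ | ENNReal.ofReal r ≤ contactTime D ω}) hle]
        refine Tendsto.mul_const _ ?_
        refine ((hg.tendsto _).comp (hcont.comp hgrid)).congr fun n => ?_
        rw [stayWeight, indicator_of_mem]
        · rfl
        · exact lt_contactTime_iff.mp
            ((ENNReal.coe_lt_coe.mpr (gridBefore_lt n hpos)).trans_le hle)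
      · rw [indicator_of_notMem (s := {r : ℝ | ENNReal.ofReal r ≤ contactTime D ω}) hle]
        refine tendsto_const_nhds.congr' ?_
        have hcoe : Tendsto (fun n => ((gridBefore n r.toNNReal : ℝ≥0) : ℝ≥0∞)) atTop
            (𝓝 (ENNReal.ofReal r)) :=
          ENNReal.tendsto_coe.mpr (tendsto_nhdsWithin_iff.mp hgrid).1
        filter_upwards [hcoe.eventually (lt_mem_nhds (not_le.mp hle))] with n hn
        rw [stayWeight, indicator_of_notMem, zero_mul]
        exact fun hc => absurd (lt_contactTime_iff.mpr hc) (not_lt.mpr hn.le)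

/-- A single jump at time `s` not later than the contact time is seen by the discretized jump
sums. -/
theorem le_liminf_jumpSum {D : Set (Euc d)} {f g : Euc d → ℝ} (hf : Continuous f)
    (hf0 : ∀ x, 0 ≤ f x) (hg : Continuous g) (hg1 : ∀ x, g x ∈ Icc (0 : ℝ) 1) {T : ℕ}
    {ω : CadlagPath d} {s : ℝ≥0} (hs : 0 < s) (hsT : s ≤ T)
    (hsc : (s : ℝ≥0∞) ≤ contactTime D ω) {l : Euc d} (hl : Tendsto ω (𝓝[<] s) (𝓝 l)) :
    ENNReal.ofReal (g l * f (ω s)) ≤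
      liminf (fun n => ENNReal.ofReal (jumpSum D g f T n ω)) atTop := by
  have h1 : Tendsto (fun n : ℕ => g (ω (gridBefore n s)) *
      f (ω (gridBefore n s + 1 / (n + 1)))) atTop (𝓝 (g l * f (ω s))) :=
    ((hg.tendsto _).comp (hl.comp (tendsto_gridBefore hs))).mul
      ((hf.tendsto _).comp ((ω.right_cont s).tendsto.comp (tendsto_gridBefore_add hs)))
  rw [← ((ENNReal.continuous_ofReal.tendsto _).comp h1).liminf_eq]
  refine liminf_le_liminf (Eventually.of_forall fun n => ENNReal.ofReal_le_ofReal ?_)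
  have hceil : 0 < ⌈s * (n + 1)⌉₊ := Nat.ceil_pos.mpr (by positivity)
  have hmem : ⌈s * (n + 1)⌉₊ - 1 ∈ Finset.range (T * (n + 1)) := by
    have : ⌈s * (n + 1)⌉₊ ≤ T * (n + 1) := by
      refine Nat.ceil_le.mpr ?_
      push_cast
      gcongr
    rw [Finset.mem_range]
    omega
  refine le_trans (le_of_eq ?_) (Finset.single_le_sum
    (fun i _ => mul_nonneg (stayWeight_nonneg D hg1 _ _) (hf0 _)) hmem)
  have hstay : ω ∈ staysInside D (gridBefore n s) :=
    lt_contactTime_iff.mp ((ENNReal.coe_lt_coe.mpr (gridBefore_lt n hs)).trans_le hsc)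
  have hadd : gridBefore n s + 1 / (n + 1) =
      (((⌈s * (n + 1)⌉₊ - 1) + 1 : ℕ) : ℝ≥0) / (n + 1) := by
    rw [gridBefore, ← add_div]
    push_cast
    rfl
  change g (ω (gridBefore n s)) * f (ω (gridBefore n s + 1 / (n + 1))) = _
  rw [hadd, ← gridBefore, stayWeight, indicator_of_mem hstay]

/-- The event of a jump, not later than `T` and the contact time with `Dᶜ`, from `G` into
`{1 ≤ f}`. -/
def jumpEvent (D : Set (Euc d)) (T : ℕ) (G : Set (Euc d)) (f : Euc d → ℝ) :
    Set (CadlagPath d) :=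
  {ω | ∃ s : ℝ≥0, 0 < s ∧ s ≤ T ∧ (s : ℝ≥0∞) ≤ contactTime D ω ∧
    ∃ l ∈ G, Tendsto ω (𝓝[<] s) (𝓝 l) ∧ 1 ≤ f (ω s)}

/-- The integral of `Af` over the occupation measure on an open set `G` where `f` vanishes controls
the probability of a jump from `G` into `{1 ≤ f}`. The weights `g` of the jump sums are Urysohn
functions that exhaust `G`. -/
theorem measure_jumpEvent_le {Q : Euc d → Matrix (Fin d) (Fin d) ℝ} {b : Euc d → Euc d}
    {N : Kernel (Euc d) (Euc d)} {P : Measure (CadlagPath d)} [IsProbabilityMeasure P]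
    (hQb : LocalCoeffCond Q b) (hN : LevyKernelCond N) (D : Set (Euc d))
    {f : Euc d → ℝ} (hf : IsCb2 f) (hM : Martingale (mpProcess Q b N f) (natFiltration d) P)
    (hf0 : ∀ x, 0 ≤ f x) {G : Set (Euc d)} (hG : IsOpen G) (hGf : ∀ x ∈ G, f x = 0) (T : ℕ) :
    P (jumpEvent D T G f) ≤ (occupation P D T).withDensity
      (fun x => ENNReal.ofReal (integroDiffOp Q b N f x)) G := by
  obtain ⟨F, hFc, hFG, hFU, hFm⟩ := hG.exists_iUnion_isClosed
  have hmono : Monotone fun n => jumpEvent D T (F n) f := by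
    rintro i j hij ω ⟨s, hs, hsT, hsc, l, hl, h⟩
    exact ⟨s, hs, hsT, hsc, l, hFm hij hl, h⟩
  have hU : jumpEvent D T G f = ⋃ n, jumpEvent D T (F n) f := by
    ext ω
    simp only [mem_iUnion]
    constructor
    · rintro ⟨s, hs, hsT, hsc, l, hl, h⟩
      rw [← hFU] at hl
      obtain ⟨n, hn⟩ := mem_iUnion.mp hl
      exact ⟨n, s, hs, hsT, hsc, l, hn, h⟩
    · rintro ⟨n, s, hs, hsT, hsc, l, hl, h⟩
      exact ⟨s, hs, hsT, hsc, l, hFG n hl, h⟩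
  rw [hU, hmono.measure_iUnion]
  refine iSup_le fun k => ?_
  obtain ⟨g, hg0, hg1, hg⟩ := exists_continuous_zero_one_of_isClosed
    (hG.isClosed_compl) (hFc k) (disjoint_left.mpr fun x hx hx' => hx (hFG k hx'))
  have hgf : ∀ x, g x * f x = 0 := by
    intro x
    by_cases hx : x ∈ G
    · rw [hGf x hx, mul_zero]
    · rw [hg0 hx, Pi.zero_apply, zero_mul]
  have hm := measurable_integroDiffOp hQb hN hf
  obtain ⟨K, hK⟩ := exists_bound_integroDiffOp hQb hN hf
  have hjm : ∀ n, Measurable fun ω => ENNReal.ofReal (jumpSum D g f T n ω) := fun n =>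
    (measurable_jumpSum D g.continuous.measurable hf.1.continuous.measurable T n).ennreal_ofReal
  have hj0 : ∀ n ω, 0 ≤ jumpSum D g f T n ω := fun n ω =>
    Finset.sum_nonneg fun i _ => mul_nonneg (stayWeight_nonneg D hg _ _) (hf0 _)
  have hji : ∀ n, Integrable (jumpSum D g f T n) P := fun n =>
    integrable_finsetSum _ fun i _ => integrable_jumpSum_term g.continuous.measurable hg hf _ _
  calc P (jumpEvent D T (F k) f)
      ≤ P {ω | 1 ≤ liminf (fun n => ENNReal.ofReal (jumpSum D g f T n ω)) atTop} := by
        refine measure_mono ?_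
        rintro ω ⟨s, hs, hsT, hsc, l, hl, hlim, h1⟩
        refine le_trans ?_ (le_liminf_jumpSum hf.1.continuous hf0 g.continuous hg hs hsT hsc hlim)
        rw [hg1 hl, Pi.one_apply, one_mul]
        exact ENNReal.one_le_ofReal.mpr h1
    _ ≤ ∫⁻ ω, liminf (fun n => ENNReal.ofReal (jumpSum D g f T n ω)) atTop ∂P := by
        have := mul_meas_ge_le_lintegral (μ := P) (Measurable.liminf hjm) 1
        rwa [one_mul] at this
    _ ≤ liminf (fun n => ∫⁻ ω, ENNReal.ofReal (jumpSum D g f T n ω) ∂P) atTop :=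
        lintegral_liminf_le hjm
    _ = ENNReal.ofReal (∫ x, g x * integroDiffOp Q b N f x ∂(occupation P D T)) := by
        refine Tendsto.liminf_eq ?_
        refine ((ENNReal.continuous_ofReal.tendsto _).comp (tendsto_integral_jumpSum hQb hN D hf
          hM g.continuous hg hgf T)).congr fun n => ?_
        exact ofReal_integral_eq_lintegral_ofReal (hji n) (Eventually.of_forall (hj0 n))
    _ ≤ ∫⁻ x, ENNReal.ofReal (g x * integroDiffOp Q b N f x) ∂(occupation P D T) := by
        have hint : Integrable (fun x => g x * integroDiffOp Q b N f x) (occupation P D T) :=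
          (Integrable.of_bound hm.aestronglyMeasurable K (Eventually.of_forall hK)).bdd_mul
            (c := 1) g.continuous.aestronglyMeasurable (Eventually.of_forall fun x => by
              rw [Real.norm_eq_abs, abs_of_nonneg (hg x).1]
              exact (hg x).2)
        rw [integral_eq_lintegral_pos_part_sub_lintegral_neg_part hint]
        exact (ENNReal.ofReal_le_ofReal (sub_le_self _ ENNReal.toReal_nonneg)).trans
          ENNReal.ofReal_toReal_le
    _ ≤ ∫⁻ x in G, ENNReal.ofReal (integroDiffOp Q b N f x) ∂(occupation P D T) := by
        rw [← lintegral_indicator hG.measurableSet]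
        refine lintegral_mono fun x => ?_
        by_cases hx : x ∈ G
        · rw [indicator_of_mem hx, ENNReal.ofReal_mul (hg x).1]
          exact mul_le_of_le_one_left zero_le (ENNReal.ofReal_le_one.mpr (hg x).2)
        · rw [hg0 hx, Pi.zero_apply, zero_mul, ENNReal.ofReal_zero]
          exact zero_le
    _ = _ := (withDensity_apply _ hG.measurableSet).symm

/-- Jumps that the Lévy kernel does not charge do not occur: almost surely there is no jump from
the part of `U` where `Af ≤ 0` or outside `D` into `{1 ≤ f}`, when `f` vanishes on `U`. -/
theorem measure_jumpEvent_eq_zero {Q : Euc d → Matrix (Fin d) (Fin d) ℝ} {b : Euc d → Euc d}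
    {N : Kernel (Euc d) (Euc d)} {P : Measure (CadlagPath d)} [IsProbabilityMeasure P]
    (hQb : LocalCoeffCond Q b) (hN : LevyKernelCond N) {D : Set (Euc d)} (hD : IsOpen D)
    {f : Euc d → ℝ} (hf : IsCb2 f) (hM : Martingale (mpProcess Q b N f) (natFiltration d) P)
    (hf0 : ∀ x, 0 ≤ f x) {U : Set (Euc d)} (hU : IsOpen U) (hUf : ∀ x ∈ U, f x = 0) (T : ℕ) :
    P (jumpEvent D T {x ∈ U | x ∈ D → integroDiffOp Q b N f x ≤ 0} f) = 0 := by
  have hm := measurable_integroDiffOp hQb hN hf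
  obtain ⟨K, hK⟩ := exists_bound_integroDiffOp hQb hN hf
  set A : Set (Euc d) := {x ∈ U | x ∈ D → integroDiffOp Q b N f x ≤ 0} with hA
  set ν := (occupation P D T).withDensity (fun x => ENNReal.ofReal (integroDiffOp Q b N f x))
  have hfin : IsFiniteMeasure ν := by
    refine isFiniteMeasure_withDensity (ne_of_lt ?_)
    refine lt_of_le_of_lt (lintegral_mono fun x =>
      ENNReal.ofReal_le_ofReal ((le_abs_self _).trans (hK x))) ?_
    rw [lintegral_const]
    exact ENNReal.mul_lt_top ENNReal.ofReal_lt_top (measure_lt_top _ _)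
  have hνA : ν A = 0 := by
    have hAm : MeasurableSet A := by
      have : A = U ∩ (Dᶜ ∪ {x | integroDiffOp Q b N f x ≤ 0}) := by
        ext x
        simp only [hA, mem_ofPred_eq, mem_inter_iff, mem_union, mem_compl_iff, imp_iff_not_or]
      rw [this]
      exact hU.measurableSet.inter
        (hD.measurableSet.compl.union (measurableSet_le hm measurable_const))
    rw [withDensity_apply _ hAm]
    refine lintegral_eq_zero_of_ae_eq_zero ?_
    have hDae : ∀ᵐ x ∂(occupation P D T), x ∈ D :=
      measure_eq_zero_iff_ae_notMem.mp (occupation_compl P hD T) |>.mono fun x hx => not_not.mp hx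
    filter_upwards [ae_restrict_of_ae hDae, ae_restrict_mem hAm] with x hxD hxA
    exact ENNReal.ofReal_eq_zero.mpr (hxA.2 hxD)
  refine le_antisymm (ENNReal.le_of_forall_pos_le_add fun ε hε _ => ?_) zero_le
  obtain ⟨G, hAG, hG, hGε⟩ := A.exists_isOpen_lt_of_lt (μ := ν) ε
    (by rw [hνA]; exact_mod_cast hε)
  rw [zero_add]
  calc P (jumpEvent D T A f) ≤ P (jumpEvent D T (G ∩ U) f) := by
        refine measure_mono ?_
        rintro ω ⟨s, hs, hsT, hsc, l, hl, h⟩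
        exact ⟨s, hs, hsT, hsc, l, ⟨hAG hl, hl.1⟩, h⟩
    _ ≤ ν (G ∩ U) := measure_jumpEvent_le hQb hN D hf hM hf0 (hG.inter hU)
        (fun x hx => hUf x hx.2) T
    _ ≤ ν G := measure_mono inter_subset_left
    _ ≤ ε := hGε.le

/-- **Jumps follow the Lévy kernel.** Almost surely, at every time `s` up to and including the
contact time with `Dᶜ`, the path is either continuous, or it jumps from a point `X_{s-}` of `D` by
an element of the support of `N(X_{s-}, ·)`. In particular it does not jump off the boundary. -/
theorem ae_jump_mem_support {Q : Euc d → Matrix (Fin d) (Fin d) ℝ} {b : Euc d → Euc d}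
    {N : Kernel (Euc d) (Euc d)} {μ : Measure (Euc d)} {P : Measure (CadlagPath d)}
    (hQb : LocalCoeffCond Q b) (hN : LevyKernelCond N) (hP : IsMartingaleSolution Q b N μ P)
    {D : Set (Euc d)} (hD : IsOpen D) :
    ∀ᵐ ω ∂P, ∀ s : ℝ≥0, 0 < s → (s : ℝ≥0∞) ≤ contactTime D ω →
      ∀ l, Tendsto ω (𝓝[<] s) (𝓝 l) → ω s = l ∨ (l ∈ D ∧ ω s - l ∈ (N l).support) := by
  have := hP.isProbabilityMeasure
  obtain ⟨C, hCc, hCd⟩ := TopologicalSpace.exists_countable_dense (Euc d)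
  have hr : ∀ n : ℕ, (0 : ℝ) < 1 / ((n : ℝ) + 1) := fun n => by positivity
  let φ : ∀ (q : Euc d), ℕ → ContDiffBump q := fun q n =>
    ⟨1 / ((n : ℝ) + 1), 2 * (1 / ((n : ℝ) + 1)), hr n, by linarith [hr n]⟩
  have hnull : ∀ᵐ ω ∂P, ∀ q ∈ C, ∀ n T : ℕ, ω ∉ jumpEvent D T
      {x ∈ (Metric.closedBall q (2 * (1 / ((n : ℝ) + 1))))ᶜ |
        x ∈ D → integroDiffOp Q b N (φ q n) x ≤ 0} (φ q n) := by
    rw [ae_ball_iff hCc]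
    intro q _
    rw [ae_all_iff]
    intro n
    rw [ae_all_iff]
    intro T
    have hf : IsCb2 (φ q n) := isCb2_of_hasCompactSupport (φ q n).contDiff
      (φ q n).hasCompactSupport
    refine measure_eq_zero_iff_ae_notMem.mp (measure_jumpEvent_eq_zero hQb hN hD hf
      (hP.martingale _ hf) (fun x => (φ q n).nonneg) Metric.isClosed_closedBall.isOpen_compl
      (fun x hx => ?_) T)
    exact (φ q n).zero_of_le_dist (lt_of_not_ge fun h => hx h).le
  filter_upwards [hnull] with ω hω s hs hsc l hl
  by_contra! hc
  obtain ⟨hne, hsupp⟩ := hc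
  -- a ball around the landing point that excludes `l` and is not charged by jumps from `l`
  obtain ⟨ε, hε, hεl, hεN⟩ : ∃ ε > 0, ε ≤ dist l (ω s) ∧
      (l ∈ D → N l {y | l + y ∈ Metric.ball (ω s) ε} = 0) := by
    have hdist : 0 < dist l (ω s) := dist_pos.mpr hne.symm
    by_cases hlD : l ∈ D
    · obtain ⟨W, hW, hW0⟩ := Measure.notMem_support_iff_exists.mp (hsupp hlD)
      obtain ⟨δ, hδ, hδW⟩ := Metric.mem_nhds_iff.mp hW
      refine ⟨min δ (dist l (ω s)), lt_min hδ hdist, min_le_right _ _, fun _ => ?_⟩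
      refine measure_mono_null (fun y hy => hδW ?_) hW0
      have hy' : dist (l + y) (ω s) < min δ (dist l (ω s)) := hy
      rw [Metric.mem_ball]
      refine lt_of_eq_of_lt ?_ (hy'.trans_le (min_le_left _ _))
      rw [dist_eq_norm, dist_eq_norm]
      congr 1
      abel
    · exact ⟨dist l (ω s), hdist, le_rfl, fun h => absurd h hlD⟩
  obtain ⟨n, hn⟩ := exists_nat_one_div_lt (show 0 < ε / 3 by positivity)
  obtain ⟨q, hq, hqC⟩ := hCd.exists_dist_lt (ω s) (hr n)
  obtain ⟨T, hT⟩ := exists_nat_ge s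
  have hball : Metric.closedBall q (2 * (1 / ((n : ℝ) + 1))) ⊆ Metric.ball (ω s) ε := by
    intro x hx
    have h1 : dist x q ≤ 2 * (1 / ((n : ℝ) + 1)) := hx
    have h2 := dist_triangle x q (ω s)
    rw [dist_comm q] at h2
    rw [Metric.mem_ball]
    linarith
  have hlU : l ∉ Metric.closedBall q (2 * (1 / ((n : ℝ) + 1))) := fun h =>
    absurd (hball h) (not_lt.mpr hεl)
  refine hω q hq n T ⟨s, hs, hT, hsc, l, ⟨hlU, fun hlD => ?_⟩, hl, ?_⟩
  · have hzero : (φ q n : Euc d → ℝ) =ᶠ[𝓝 l] 0 := by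
      filter_upwards [Metric.isClosed_closedBall.isOpen_compl.mem_nhds hlU] with x hx
      exact (φ q n).zero_of_le_dist (lt_of_not_ge fun h => hx h).le
    rw [integroDiffOp_eq_of_eventuallyEq_zero hzero]
    refine le_of_eq (integral_eq_zero_of_ae ?_)
    filter_upwards [measure_eq_zero_iff_ae_notMem.mp (hεN hlD)] with y hy
    refine (φ q n).zero_of_le_dist (not_lt.mp fun hlt => hy (hball ?_))
    exact le_of_lt hlt
  · exact ((φ q n).one_of_mem_closedBall hqC.le).ge

end Jumps

/-! ### Exit time and exit position -/

section Exit

variable {d : ℕ}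

theorem contactTime_pos {D : Set (Euc d)} (hD : IsOpen D) {ω : CadlagPath d} (h0 : ω 0 ∈ D) :
    0 < contactTime D ω := by
  have hpos : Metric.infEDist (ω 0) Dᶜ ≠ 0 := fun h =>
    (Metric.mem_iff_infEDist_zero_of_closed hD.isClosed_compl).mpr h h0
  obtain ⟨n, hn⟩ := ENNReal.exists_inv_nat_lt hpos
  rw [← ENNReal.coe_zero, lt_contactTime_iff]
  refine ⟨n, fun s hs => ?_⟩
  rw [nonpos_iff_eq_zero.mp hs]
  refine le_trans ?_ hn.le
  rw [ENNReal.inv_le_inv]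
  exact le_self_add

/-- A path in `D` that keeps a positive distance from `Dᶜ` before `s`, in the left limit at `s` and
at `s` itself, keeps a positive distance on `[0, s]`. -/
theorem lt_contactTime_of_leftLim_mem {D : Set (Euc d)} (hD : IsOpen D) {ω : CadlagPath d}
    {s : ℝ≥0} (hs : 0 < s) (hlt : ∀ r < s, (r : ℝ≥0∞) < contactTime D ω) {l : Euc d}
    (hl : Tendsto ω (𝓝[<] s) (𝓝 l)) (hlD : l ∈ D) (hsD : ω s ∈ D) :
    (s : ℝ≥0∞) < contactTime D ω := by
  have hpos : ∀ y ∈ D, ∃ n : ℕ, (n : ℝ≥0∞)⁻¹ < Metric.infEDist y Dᶜ := fun y hy =>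
    ENNReal.exists_inv_nat_lt fun h =>
      (Metric.mem_iff_infEDist_zero_of_closed hD.isClosed_compl).mpr h hy
  obtain ⟨n₁, h₁⟩ := hpos l hlD
  obtain ⟨n₂, h₂⟩ := hpos _ hsD
  have hev : ∀ᶠ r in 𝓝[<] s, (n₁ : ℝ≥0∞)⁻¹ < Metric.infEDist (ω r) Dᶜ :=
    ((Metric.continuous_infEDist.tendsto l).comp hl).eventually (lt_mem_nhds h₁)
  obtain ⟨a, ha, hsub⟩ := (mem_nhdsLT_iff_exists_Ioo_subset' hs).mp hev
  obtain ⟨q, haq, hqs⟩ := exists_between (mem_Iio.mp ha)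
  obtain ⟨n₃, h₃⟩ := lt_contactTime_iff.mp (hlt q hqs)
  have hinv : ∀ k : ℕ, k ≤ n₁ + n₂ + n₃ →
      (((n₁ + n₂ + n₃ : ℕ) : ℝ≥0∞) + 1)⁻¹ ≤ (k : ℝ≥0∞)⁻¹ := by
    intro k hk
    rw [ENNReal.inv_le_inv]
    exact_mod_cast hk.trans (Nat.le_succ _)
  refine lt_contactTime_iff.mpr ⟨n₁ + n₂ + n₃, fun r hr => ?_⟩
  rcases eq_or_lt_of_le hr with rfl | hrs
  · exact (hinv n₂ (by omega)).trans h₂.le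
  rcases le_or_gt r q with hrq | hrq
  · refine le_trans ?_ (h₃ r hrq)
    rw [ENNReal.inv_le_inv]
    exact_mod_cast Nat.succ_le_succ (by omega)
  · have : (n₁ : ℝ≥0∞)⁻¹ < Metric.infEDist (ω r) Dᶜ := hsub ⟨haq.trans hrq, hrs⟩
    exact (hinv n₁ (by omega)).trans this.le

/-- If the jumps up to the contact time start in `D` and follow the Lévy kernel, then the path
leaves `D` exactly at the contact time, and lands in the extended boundary. -/
theorem exit_of_jump_mem_support {N : Kernel (Euc d) (Euc d)} {D : Set (Euc d)} (hD : IsOpen D)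
    {ω : CadlagPath d} (h0 : ω 0 ∈ D)
    (hJ : ∀ s : ℝ≥0, 0 < s → (s : ℝ≥0∞) ≤ contactTime D ω →
      ∀ l, Tendsto ω (𝓝[<] s) (𝓝 l) → ω s = l ∨ (l ∈ D ∧ ω s - l ∈ (N l).support)) :
    exitTime D ω = contactTime D ω ∧
      ∀ s : ℝ≥0, (s : ℝ≥0∞) = exitTime D ω → ω s ∉ D ∧ ω s ∈ extBoundary N D := by
  have key : ∀ s : ℝ≥0, (s : ℝ≥0∞) = contactTime D ω → 0 < s ∧ ω s ∉ D ∧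
      ω s ∈ extBoundary N D := by
    intro s hs
    have hs0 : 0 < s := by
      have := contactTime_pos hD h0
      rw [← hs] at this
      exact_mod_cast this
    have hne : (𝓝[<] s).NeBot := nhdsLT_neBot_of_exists_lt ⟨0, hs0⟩
    have hlt : ∀ r < s, (r : ℝ≥0∞) < contactTime D ω := fun r hr => by
      rw [← hs]
      exact_mod_cast hr
    obtain ⟨l, hl⟩ := ω.left_lim s
    have hsD : ω s ∉ D := by
      intro hsD
      have hlD : l ∈ D := by
        rcases hJ s hs0 hs.le l hl with h | h
        · exact h ▸ hsD
        · exact h.1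
      exact absurd hs (lt_contactTime_of_leftLim_mem hD hs0 hlt hl hlD hsD).ne
    refine ⟨hs0, hsD, ?_⟩
    rcases hJ s hs0 hs.le l hl with h | ⟨hlD, hls⟩
    · left
      rw [hD.frontier_eq]
      refine ⟨?_, hsD⟩
      rw [h]
      refine mem_closure_of_tendsto hl ?_
      filter_upwards [self_mem_nhdsWithin] with r hr
      exact mem_of_mem_staysInside (lt_contactTime_iff.mp (hlt r hr)) le_rfl
    · right
      refine ⟨mem_iUnion₂.mpr ⟨l, hlD, ω s - l, hls, ?_⟩, hsD⟩
      change l + (ω s - l) = ω s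
      abel
  have heq : exitTime D ω = contactTime D ω := by
    refine le_antisymm ?_ (contactTime_le_exitTime ω)
    rcases eq_or_ne (contactTime D ω) ⊤ with htop | htop
    · rw [htop]
      exact le_top
    · obtain ⟨s, hs⟩ : ∃ s : ℝ≥0, (s : ℝ≥0∞) = contactTime D ω :=
        ⟨_, ENNReal.coe_toNNReal htop⟩
      obtain ⟨hs0, hsD, -⟩ := key s hs
      rw [← hs]
      exact exitTime_le hs0 hsD
  exact ⟨heq, fun s hs => (key s (hs.trans heq)).2⟩

variable {Q : Euc d → Matrix (Fin d) (Fin d) ℝ} {b : Euc d → Euc d} {N : Kernel (Euc d) (Euc d)}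
  {P : Kernel (Euc d) (CadlagPath d)} {D : Set (Euc d)}

theorem IsStrongMarkovSolution.isMarkovKernel (hP : IsStrongMarkovSolution Q b N P) :
    IsMarkovKernel P :=
  ⟨fun x => (hP.solution x).isProbabilityMeasure⟩

/-- For a starting point in `D`, the exit time is almost surely the contact time, and the exit
position lies in the extended boundary. -/
theorem ae_exit (hQb : LocalCoeffCond Q b) (hN : LevyKernelCond N)
    (hP : IsStrongMarkovSolution Q b N P) (hD : IsOpen D) {x : Euc d} (hx : x ∈ D) :
    ∀ᵐ ω ∂(P x), ω 0 = x ∧ exitTime D ω = contactTime D ω ∧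
      ∀ s : ℝ≥0, (s : ℝ≥0∞) = exitTime D ω → ω s ∉ D ∧ ω s ∈ extBoundary N D := by
  have h0 : ∀ᵐ ω ∂(P x), ω 0 = x := by
    refine ae_of_ae_map (measurable_eval 0).aemeasurable (p := fun y => y = x) ?_
    rw [(hP.solution x).initial]
    simp [ae_dirac_eq]
  filter_upwards [h0, ae_jump_mem_support hQb hN (hP.solution x) hD] with ω h0 hJ
  exact ⟨h0, exit_of_jump_mem_support hD (h0 ▸ hx) hJ⟩

theorem exitTimeMin_of_lt {ω : CadlagPath d} {t : ℝ≥0} (h : (t : ℝ≥0∞) < exitTime D ω) :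
    exitTimeMin D t ω = t := by
  rw [exitTimeMin, min_eq_right h.le, ENNReal.toNNReal_coe]

theorem coe_exitTimeMin_of_le {ω : CadlagPath d} {t : ℝ≥0} (h : exitTime D ω ≤ t) :
    (exitTimeMin D t ω : ℝ≥0∞) = exitTime D ω := by
  rw [exitTimeMin, min_eq_left h, ENNReal.coe_toNNReal (h.trans_lt ENNReal.coe_lt_top).ne]

theorem coe_exitTimeMin (ω : CadlagPath d) (t : ℝ≥0) :
    (exitTimeMin D t ω : ℝ≥0∞) = min (exitTime D ω) t := by
  rw [exitTimeMin, ENNReal.coe_toNNReal]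
  exact ((min_le_right _ _).trans_lt ENNReal.coe_lt_top).ne

theorem aemeasurable_exitTimeMin (hQb : LocalCoeffCond Q b) (hN : LevyKernelCond N)
    (hP : IsStrongMarkovSolution Q b N P) (hD : IsOpen D) {x : Euc d} (hx : x ∈ D) (t : ℝ≥0) :
    AEMeasurable (exitTimeMin D t) (P x) := by
  refine ⟨fun ω => (min (contactTime D ω) t).toNNReal,
    (measurable_contactTime.min measurable_const).ennreal_toNNReal, ?_⟩
  filter_upwards [ae_exit hQb hN hP hD hx] with ω hω
  rw [exitTimeMin, hω.2.1]

/-- Along a path started in `D`, only the values of `c` on `D` enter the functional up to the exit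
time. -/
theorem expFunctional_exitTimeMin {ω : CadlagPath d} (h0 : ω 0 ∈ D) (c : Euc d → ℝ) (t : ℝ≥0) :
    expFunctional c (exitTimeMin D t ω) ω = Real.exp (-∫ r in Ioc (0 : ℝ) (exitTimeMin D t ω),
      D.indicator c (ω r.toNNReal)) := by
  rw [expFunctional, intervalIntegral.integral_of_le (NNReal.coe_nonneg _),
    integral_Ioc_eq_integral_Ioo, integral_Ioc_eq_integral_Ioo]
  congr 2
  refine setIntegral_congr_fun measurableSet_Ioo fun r hr => ?_
  refine (indicator_of_mem (mem_of_lt_exitTime h0 ?_) c).symm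
  have h1 : r.toNNReal < exitTimeMin D t ω := (Real.toNNReal_lt_iff_lt_coe hr.1.le).mpr hr.2
  refine (ENNReal.coe_lt_coe.mpr h1).trans_le ?_
  rw [coe_exitTimeMin]
  exact min_le_left _ _

theorem measurable_indicator_of_isBddNonnegOn (hD : IsOpen D) {f : Euc d → ℝ}
    (hf : IsBddNonnegOn D f) : Measurable (D.indicator f) := by
  refine measurable_of_restrict_of_restrict_compl hD.measurableSet ?_ ?_
  · have h : D.domRestrict (D.indicator f) = D.domRestrict f := by
      ext y
      exact indicator_of_mem y.2 f
    rw [h]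
    exact hf.1
  · have h : Dᶜ.domRestrict (D.indicator f) = fun _ => 0 := by
      ext y
      exact indicator_of_notMem y.2 f
    rw [h]
    exact measurable_const

theorem indicator_nonneg_of_isBddNonnegOn {f : Euc d → ℝ} (hf : IsBddNonnegOn D f) (x : Euc d) :
    0 ≤ D.indicator f x := by
  obtain ⟨C, hC⟩ := hf.2
  exact indicator_nonneg (fun y hy => (hC y hy).1) x

theorem expFunctional_exitTimeMin_le_one {ω : CadlagPath d} (h0 : ω 0 ∈ D) {c : Euc d → ℝ}
    (hc : IsBddNonnegOn D c) (t : ℝ≥0) : expFunctional c (exitTimeMin D t ω) ω ≤ 1 := by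
  rw [expFunctional_exitTimeMin h0, Real.exp_le_one_iff, neg_nonpos]
  exact integral_nonneg fun r => indicator_nonneg_of_isBddNonnegOn hc _

theorem aemeasurable_expFunctional_exitTimeMin (hQb : LocalCoeffCond Q b) (hN : LevyKernelCond N)
    (hP : IsStrongMarkovSolution Q b N P) (hD : IsOpen D) {x : Euc d} (hx : x ∈ D)
    {c : Euc d → ℝ} (hc : IsBddNonnegOn D c) (t : ℝ≥0) :
    AEMeasurable (fun ω => expFunctional c (exitTimeMin D t ω) ω) (P x) := by
  obtain ⟨T, hT, hTeq⟩ := aemeasurable_exitTimeMin hQb hN hP hD hx t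
  have hm : Measurable fun ω : CadlagPath d => ∫ r : ℝ,
      {p : CadlagPath d × ℝ | 0 < p.2 ∧ p.2 ≤ T p.1}.indicator
        (fun p => D.indicator c (p.1 p.2.toNNReal)) (ω, r) := by
    refine (StronglyMeasurable.integral_prod_right' (Measurable.stronglyMeasurable ?_)).measurable
    refine Measurable.indicator ((measurable_indicator_of_isBddNonnegOn hD hc).comp
      (measurable_eval_toNNReal.comp measurable_swap)) ?_
    exact (measurableSet_lt measurable_const measurable_snd).inter
      (measurableSet_le measurable_snd (by fun_prop))
  refine ⟨_, (hm.neg).exp, ?_⟩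
  filter_upwards [hTeq, ae_exit hQb hN hP hD hx] with ω hω hex
  rw [expFunctional_exitTimeMin (by rw [hex.1]; exact hx), ← integral_indicator measurableSet_Ioc,
    hω]
  rfl

/-- For starting points in `D`, the contact time may replace the exit time in the semigroup of the
killed process. -/
theorem killedSemigroup_eq (hQb : LocalCoeffCond Q b) (hN : LevyKernelCond N)
    (hP : IsStrongMarkovSolution Q b N P) (hD : IsOpen D) {x : Euc d} (hx : x ∈ D) (t : ℝ≥0)
    (f : Euc d → ℝ) : killedSemigroup P D t f x =
      ∫⁻ ω in staysInside D t, ENNReal.ofReal (D.indicator f (ω t)) ∂(P x) := by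
  have hset : ({ω | (t : ℝ≥0∞) < exitTime D ω} : Set (CadlagPath d)) =ᵐ[P x]
      staysInside D t := by
    filter_upwards [ae_exit hQb hN hP hD hx] with ω hω
    refine propext ?_
    change (t : ℝ≥0∞) < exitTime D ω ↔ ω ∈ staysInside D t
    rw [hω.2.1, lt_contactTime_iff]
  rw [killedSemigroup, Measure.restrict_congr_set hset]
  refine setLIntegral_congr_fun ((natFiltration d).le t _ (measurableSet_staysInside t))
    fun ω hω => ?_
  rw [indicator_of_mem (mem_of_mem_staysInside hω le_rfl)]

end Exit

/-! ### Irreducibility implies the maximum principle -/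

section MaxPrinciple

variable {d : ℕ} {Q : Euc d → Matrix (Fin d) (Fin d) ℝ} {b : Euc d → Euc d}
  {N : Kernel (Euc d) (Euc d)} {P : Kernel (Euc d) (CadlagPath d)} {D : Set (Euc d)}

theorem IsWeakSubsolution.bddAbove_image {c u : Euc d → ℝ} (hu : IsWeakSubsolution P D c u)
    (S : Set (Euc d)) : BddAbove (u '' S) := by
  obtain ⟨C, hC⟩ := hu.bounded
  refine ⟨C, ?_⟩
  rintro _ ⟨x, -, rfl⟩
  exact (le_abs_self _).trans (hC x)

/-- Propagation of the maximum: a weak subsolution that attains its non-negative supremum over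
`D_S` at `x₀ ∈ D` equals this supremum along almost every path from `x₀`, up to the exit time. -/
theorem IsWeakSubsolution.ae_eq_sSup (hQb : LocalCoeffCond Q b) (hN : LevyKernelCond N)
    (hP : IsStrongMarkovSolution Q b N P) (hD : IsOpen D) {c u : Euc d → ℝ}
    (hc : IsBddNonnegOn D c) (hu : IsWeakSubsolution P D c u) {x₀ : Euc d} (hx₀ : x₀ ∈ D)
    (hmax : u x₀ = sSup (u '' extDomain N D)) (h0 : 0 ≤ sSup (u '' extDomain N D)) (t : ℝ≥0) :
    ∀ᵐ ω ∂(P x₀), u (ω (exitTimeMin D t ω)) = sSup (u '' extDomain N D) := by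
  have := hP.isMarkovKernel
  set M := sSup (u '' extDomain N D)
  set e : CadlagPath d → ℝ := fun ω => expFunctional c (exitTimeMin D t ω) ω
  set v : CadlagPath d → ℝ := fun ω => u (ω (exitTimeMin D t ω))
  have hex := ae_exit hQb hN hP hD hx₀
  have he : ∀ᵐ ω ∂(P x₀), 0 < e ω ∧ e ω ≤ 1 := by
    filter_upwards [hex] with ω hω
    exact ⟨Real.exp_pos _, expFunctional_exitTimeMin_le_one (by rw [hω.1]; exact hx₀) hc t⟩
  have hv : ∀ᵐ ω ∂(P x₀), v ω ≤ M := by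
    filter_upwards [hex] with ω hω
    refine le_csSup (hu.bddAbove_image _) (mem_image_of_mem u ?_)
    rcases lt_or_ge (t : ℝ≥0∞) (exitTime D ω) with h | h
    · right
      rw [exitTimeMin_of_lt h]
      exact mem_of_lt_exitTime (by rw [hω.1]; exact hx₀) h
    · left
      exact (hω.2.2 _ (coe_exitTimeMin_of_le h)).2
  have hvm : AEMeasurable v (P x₀) :=
    (hu.measurable.comp measurable_uncurry).comp_aemeasurable
      ((aemeasurable_exitTimeMin hQb hN hP hD hx₀ t).prodMk aemeasurable_id)
  have hem : AEMeasurable e (P x₀) :=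
    aemeasurable_expFunctional_exitTimeMin hQb hN hP hD hx₀ hc t
  have hint : Integrable (fun ω => e ω * v ω) (P x₀) := by
    obtain ⟨C, hC⟩ := hu.bounded
    refine Integrable.bdd_mul (c := 1) (Integrable.of_bound hvm.aestronglyMeasurable C
      (Eventually.of_forall fun ω => hC _)) hem.aestronglyMeasurable ?_
    filter_upwards [he] with ω hω
    rw [Real.norm_eq_abs, abs_of_pos hω.1]
    exact hω.2
  have hle : ∀ᵐ ω ∂(P x₀), e ω * v ω ≤ M := by
    filter_upwards [he, hv] with ω h1 h2
    exact (mul_le_mul_of_nonneg_left h2 h1.1.le).trans (mul_le_of_le_one_left h0 h1.2)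
  have hzero : ∫ ω, (M - e ω * v ω) ∂(P x₀) = 0 := by
    refine le_antisymm ?_ (integral_nonneg_of_ae (hle.mono fun ω h => sub_nonneg.mpr h))
    rw [integral_sub (integrable_const _) hint, integral_const, probReal_univ, one_smul,
      sub_nonpos, ← hmax]
    exact hu.le_expectation x₀ hx₀ t
  have hae := (integral_eq_zero_iff_of_nonneg_ae (hle.mono fun ω h => sub_nonneg.mpr h)
    ((integrable_const M).sub hint)).mp hzero
  filter_upwards [hae, he, hv] with ω h1 h2 h3
  have h4 : M = e ω * v ω := sub_eq_zero.mp h1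
  refine le_antisymm h3 (not_lt.mp fun hlt => ?_)
  have h5 : e ω * v ω < e ω * M := mul_lt_mul_of_pos_left hlt h2.1
  have h6 : e ω * M ≤ M := mul_le_of_le_one_left h0 h2.2
  linarith

theorem StrongMaxPrinciple.of_resolventIrreducible (hQb : LocalCoeffCond Q b)
    (hN : LevyKernelCond N) (hP : IsStrongMarkovSolution Q b N P) (hD : IsOpen D)
    {m : Measure (Euc d)} (hIR : ResolventIrreducible P D m) : StrongMaxPrinciple N P D m := by
  intro c hc u hu x₀ hx₀ hmax h0
  set M := sSup (u '' extDomain N D)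
  have hlt : MeasurableSet {x | u x < M} := measurableSet_lt hu.measurable measurable_const
  set f : Euc d → ℝ := {x | u x < M}.indicator fun _ => 1
  have hfm : Measurable f := measurable_const.indicator hlt
  have hf : IsBddNonnegOn D f := by
    refine ⟨hfm.comp measurable_subtype_coe, 1, fun x _ => ⟨?_, ?_⟩⟩
    · exact indicator_nonneg (fun _ _ => zero_le_one) x
    · exact indicator_le_self' (f := fun _ => (1 : ℝ)) (fun _ _ => zero_le_one) x
  have hR : killedResolvent P D 1 f x₀ = 0 := by
    rw [killedResolvent]
    refine lintegral_eq_zero_of_ae_eq_zero (Eventually.of_forall fun r => ?_)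
    have hK : killedSemigroup P D r.toNNReal f x₀ = 0 := by
      rw [killedSemigroup_eq hQb hN hP hD hx₀]
      refine lintegral_eq_zero_of_ae_eq_zero ?_
      filter_upwards [ae_restrict_of_ae (hu.ae_eq_sSup hQb hN hP hD hc hx₀ hmax h0 r.toNNReal),
        ae_restrict_of_ae (ae_exit hQb hN hP hD hx₀),
        ae_restrict_mem ((natFiltration d).le _ _ (measurableSet_staysInside r.toNNReal))]
        with ω h1 h2 h3
      have h4 : (r.toNNReal : ℝ≥0∞) < exitTime D ω := by
        rw [h2.2.1]
        exact lt_contactTime_iff.mpr h3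
      rw [exitTimeMin_of_lt h4] at h1
      have h5 : f (ω r.toNNReal) = 0 := indicator_of_notMem
        (s := {x | u x < M}) (fun h => (show u (ω r.toNNReal) < M from h).ne h1) _
      rw [indicator_of_mem (mem_of_mem_staysInside h3 le_rfl), h5, ENNReal.ofReal_zero]
      rfl
    simp [hK]
  have hzero : ∫⁻ x in D, ENNReal.ofReal (f x) ∂m = 0 := by
    by_contra hne
    exact absurd hR (hIR f hf (pos_iff_ne_zero.mpr hne) x₀ hx₀).ne'
  rw [lintegral_eq_zero_iff hfm.ennreal_ofReal] at hzero
  filter_upwards [hzero, ae_restrict_mem hD.measurableSet] with x hx hxD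
  refine le_antisymm (le_csSup (hu.bddAbove_image _) (mem_image_of_mem u (Or.inr hxD))) ?_
  refine not_lt.mp fun hlt => ?_
  have h1 : f x = 1 := indicator_of_mem (s := {x | u x < M}) hlt _
  rw [h1] at hx
  simp at hx

end MaxPrinciple

/-! ### The maximum principle implies irreducibility -/

section Irreducible

variable {d : ℕ} {Q : Euc d → Matrix (Fin d) (Fin d) ℝ} {b : Euc d → Euc d}
  {N : Kernel (Euc d) (Euc d)} {P : Kernel (Euc d) (CadlagPath d)} {D : Set (Euc d)}

/-- The Markov property at a deterministic time, in integrated form. -/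
theorem IsStrongMarkov.setLIntegral_shift (hP : IsStrongMarkov P) (x : Euc d) (t : ℝ≥0)
    {F : Set (CadlagPath d)} (hF : MeasurableSet[natFiltration d t] F)
    {Φ : CadlagPath d → ℝ≥0∞} (hΦ : Measurable Φ) :
    ∫⁻ ω in F, Φ (shift t ω) ∂(P x) = ∫⁻ ω in F, ∫⁻ ω', Φ ω' ∂(P (ω t)) ∂(P x) := by
  have hFm : MeasurableSet F := (natFiltration d).le t _ hF
  have hker : Measurable fun ω : CadlagPath d => P (ω t) := P.measurable.comp (measurable_eval t)
  have hmeas : ((P x).restrict F).map (shift t) = ((P x).restrict F).bind fun ω => P (ω t) := by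
    ext B hB
    have hσ := isStoppingTime_const (natFiltration d) t
    have hF' : MeasurableSet[hσ.measurableSpace] F := by
      rw [IsStoppingTime.measurableSpace_const]
      exact hF
    have h : P x (F ∩ {ω | WithTop.some t ≠ ⊤ ∧ shift t ω ∈ B}) =
        ∫⁻ ω in F ∩ {_ω | WithTop.some t ≠ ⊤}, P (ω t) B ∂(P x) :=
      hP x (fun _ => WithTop.some t) hσ F hF' B hB
    simp only [ne_eq, WithTop.coe_ne_top, not_false_eq_true, true_and, ofPred_true,
      inter_univ] at h
    rw [Measure.map_apply (measurable_shift t) hB, Measure.bind_apply hB hker.aemeasurable,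
      Measure.restrict_apply (measurable_shift t hB), inter_comm]
    exact h
  rw [← lintegral_map hΦ (measurable_shift t), hmeas,
    Measure.lintegral_bind hker.aemeasurable hΦ.aemeasurable]

/-- Discounted occupation functional `∫_0^∞ e^{-α r} F(X_r) dr`, up to the contact time. -/
def discountedOccupation (D : Set (Euc d)) (α : ℝ) (F : Euc d → ℝ≥0∞) (ω : CadlagPath d) :
    ℝ≥0∞ :=
  ∫⁻ r in Ioi (0 : ℝ), ENNReal.ofReal (Real.exp (-α * r)) *
    (staysInside D r.toNNReal).indicator (fun ω => F (ω r.toNNReal)) ω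

theorem measurable_discountedOccupation_integrand (α : ℝ) {F : Euc d → ℝ≥0∞}
    (hF : Measurable F) : Measurable fun p : CadlagPath d × ℝ =>
      ENNReal.ofReal (Real.exp (-α * p.2)) *
        (staysInside D p.2.toNNReal).indicator (fun ω => F (ω p.2.toNNReal)) p.1 := by
  refine Measurable.mul (by fun_prop) ?_
  have heq : (fun p : CadlagPath d × ℝ =>
      (staysInside D p.2.toNNReal).indicator (fun ω => F (ω p.2.toNNReal)) p.1) =
      {p : CadlagPath d × ℝ | (p.2.toNNReal : ℝ≥0∞) < contactTime D p.1}.indicator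
        fun p => F (p.1 p.2.toNNReal) := by
    ext p
    by_cases h : p.1 ∈ staysInside D p.2.toNNReal
    · rw [indicator_of_mem h, indicator_of_mem]
      exact lt_contactTime_iff.mpr h
    · rw [indicator_of_notMem h, indicator_of_notMem]
      exact fun hc => h (lt_contactTime_iff.mp hc)
  rw [heq]
  exact (hF.comp (measurable_eval_toNNReal.comp measurable_swap)).indicator
    (measurableSet_lt (by fun_prop) (measurable_contactTime.comp measurable_fst))

theorem measurable_discountedOccupation (α : ℝ) {F : Euc d → ℝ≥0∞} (hF : Measurable F) :
    Measurable (discountedOccupation D α F) :=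
  (measurable_discountedOccupation_integrand α hF).lintegral_prod_right'

/-- Restarting at a time `t` at which the path is still inside `D` discards the occupation during
`[0, t]`. -/
theorem exp_mul_discountedOccupation_shift_le (α : ℝ) (F : Euc d → ℝ≥0∞) {t : ℝ≥0}
    {ω : CadlagPath d} (hω : ω ∈ staysInside D t) :
    ENNReal.ofReal (Real.exp (-α * t)) * discountedOccupation D α F (shift t ω) ≤
      discountedOccupation D α F ω := by
  let k : ℝ → ℝ≥0∞ := fun r => ENNReal.ofReal (Real.exp (-α * r)) *
    (staysInside D r.toNNReal).indicator (fun ω => F (ω r.toNNReal)) ω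
  have hpt : ∀ r ∈ Ioi (0 : ℝ), ENNReal.ofReal (Real.exp (-α * t)) *
      (ENNReal.ofReal (Real.exp (-α * r)) *
        (staysInside D r.toNNReal).indicator (fun ω => F (ω r.toNNReal)) (shift t ω)) ≤
      (Ioi (0 : ℝ)).indicator k (t + r) := by
    intro r hr
    have hr0 : (0 : ℝ) < r := hr
    rw [indicator_of_mem (show (t : ℝ) + r ∈ Ioi (0 : ℝ) from by
      have := t.coe_nonneg
      rw [mem_Ioi]
      linarith), ← mul_assoc, ← ENNReal.ofReal_mul (Real.exp_nonneg _), ← Real.exp_add, ← mul_add]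
    refine mul_le_mul_right ?_ _
    have htr : ((t : ℝ) + r).toNNReal = t + r.toNNReal := by
      rw [Real.toNNReal_add t.coe_nonneg hr0.le, Real.toNNReal_coe]
    by_cases h : shift t ω ∈ staysInside D r.toNNReal
    · rw [indicator_of_mem h, indicator_of_mem, htr]
      · rfl
      · rw [htr]
        obtain ⟨n₁, h₁⟩ := hω
        obtain ⟨n₂, h₂⟩ := h
        refine ⟨n₁ + n₂, fun s hs => ?_⟩
        rcases le_total s t with hst | hst
        · refine le_trans ?_ (h₁ s hst)
          rw [ENNReal.inv_le_inv]
          exact_mod_cast Nat.succ_le_succ (Nat.le_add_right _ _)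
        · have h3 := h₂ (s - t) (tsub_le_iff_left.mpr hs)
          have h4 : (shift t ω) (s - t) = ω s := by
            change ω (t + (s - t)) = ω s
            rw [add_tsub_cancel_of_le hst]
          rw [h4] at h3
          refine le_trans ?_ h3
          rw [ENNReal.inv_le_inv]
          exact_mod_cast Nat.succ_le_succ (Nat.le_add_left _ _)
    · rw [indicator_of_notMem h]
      exact zero_le
  calc ENNReal.ofReal (Real.exp (-α * t)) * discountedOccupation D α F (shift t ω)
      = ∫⁻ r in Ioi (0 : ℝ), ENNReal.ofReal (Real.exp (-α * t)) *
        (ENNReal.ofReal (Real.exp (-α * r)) *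
          (staysInside D r.toNNReal).indicator (fun ω => F (ω r.toNNReal)) (shift t ω)) := by
        rw [discountedOccupation, lintegral_const_mul' _ _ ENNReal.ofReal_ne_top]
    _ ≤ ∫⁻ r in Ioi (0 : ℝ), (Ioi (0 : ℝ)).indicator k (t + r) :=
        setLIntegral_mono' measurableSet_Ioi hpt
    _ ≤ ∫⁻ r, (Ioi (0 : ℝ)).indicator k (t + r) := setLIntegral_le_lintegral _ _
    _ = ∫⁻ r, (Ioi (0 : ℝ)).indicator k r := lintegral_add_left_eq_self _ _
    _ = discountedOccupation D α F ω := lintegral_indicator measurableSet_Ioi _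

/-- The resolvent of the process killed at the contact time, as a function on the whole space. It
agrees with `killedResolvent` on `D`, and is Borel measurable. -/
def contactResolvent (P : Kernel (Euc d) (CadlagPath d)) (D : Set (Euc d)) (α : ℝ)
    (F : Euc d → ℝ≥0∞) (x : Euc d) : ℝ≥0∞ :=
  ∫⁻ ω, discountedOccupation D α F ω ∂(P x)

theorem measurable_contactResolvent (α : ℝ) {F : Euc d → ℝ≥0∞} (hF : Measurable F) :
    Measurable (contactResolvent P D α F) :=
  (measurable_discountedOccupation α hF).lintegral_kernel

theorem killedResolvent_eq (hQb : LocalCoeffCond Q b) (hN : LevyKernelCond N)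
    (hP : IsStrongMarkovSolution Q b N P) (hD : IsOpen D) {x : Euc d} (hx : x ∈ D) (α : ℝ)
    {f : Euc d → ℝ} (hf : IsBddNonnegOn D f) : killedResolvent P D α f x =
      contactResolvent P D α (fun y => ENNReal.ofReal (D.indicator f y)) x := by
  have := hP.isMarkovKernel
  have hF : Measurable fun y => ENNReal.ofReal (D.indicator f y) :=
    (measurable_indicator_of_isBddNonnegOn hD hf).ennreal_ofReal
  simp only [killedResolvent, contactResolvent, discountedOccupation]
  rw [lintegral_lintegral_swap
    (measurable_discountedOccupation_integrand (D := D) α hF).aemeasurable]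
  refine lintegral_congr fun r => ?_
  rw [killedSemigroup_eq hQb hN hP hD hx, lintegral_const_mul' _ _ ENNReal.ofReal_ne_top,
    lintegral_indicator ((natFiltration d).le _ _ (measurableSet_staysInside _))]

/-- The resolvent is `α`-supermedian, by the Markov property. -/
theorem exp_mul_contactResolvent_le (hP : IsStrongMarkov P) (x : Euc d) (α : ℝ) (t : ℝ≥0)
    {F : Euc d → ℝ≥0∞} (hF : Measurable F) :
    ∫⁻ ω in staysInside D t, ENNReal.ofReal (Real.exp (-α * t)) *
      contactResolvent P D α F (ω t) ∂(P x) ≤ contactResolvent P D α F x := by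
  have hm := (natFiltration d).le t _ (measurableSet_staysInside (D := D) t)
  rw [lintegral_const_mul' _ _ ENNReal.ofReal_ne_top]
  simp only [contactResolvent]
  rw [← hP.setLIntegral_shift x t (measurableSet_staysInside t)
    (measurable_discountedOccupation α hF), ← lintegral_const_mul' _ _ ENNReal.ofReal_ne_top]
  refine (setLIntegral_mono' hm fun ω hω =>
    exp_mul_discountedOccupation_shift_le α F hω).trans ?_
  exact setLIntegral_le_lintegral _ _

theorem exists_contactResolvent_le [IsMarkovKernel P] {α : ℝ} (hα : 0 < α) {F : Euc d → ℝ≥0∞}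
    {C : ℝ≥0} (hF : ∀ x, F x ≤ C) : ∃ K : ℝ≥0, ∀ x, contactResolvent P D α F x ≤ K := by
  have hfin : (∫⁻ r in Ioi (0 : ℝ), ENNReal.ofReal (Real.exp (-α * r))) * C < ⊤ :=
    ENNReal.mul_lt_top (Integrable.lintegral_lt_top (exp_neg_integrableOn_Ioi 0 hα))
      ENNReal.coe_lt_top
  refine ⟨((∫⁻ r in Ioi (0 : ℝ), ENNReal.ofReal (Real.exp (-α * r))) * C).toNNReal, fun x => ?_⟩
  rw [ENNReal.coe_toNNReal hfin.ne]
  have hω : ∀ ω, discountedOccupation D α F ω ≤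
      (∫⁻ r in Ioi (0 : ℝ), ENNReal.ofReal (Real.exp (-α * r))) * C := by
    intro ω
    rw [← lintegral_mul_const' _ _ ENNReal.coe_ne_top]
    refine lintegral_mono fun r => mul_le_mul_right ?_ _
    exact indicator_le' (fun _ _ => hF _) (fun _ _ => zero_le) ω
  refine (lintegral_mono hω).trans ?_
  rw [lintegral_const, measure_univ, mul_one]

/-- Vanishing of the resolvent at a point does not depend on the discount rate. -/
theorem contactResolvent_eq_zero_of_eq_zero {α β : ℝ} {F : Euc d → ℝ≥0∞} (hF : Measurable F)
    {x : Euc d} (h : contactResolvent P D α F x = 0) : contactResolvent P D β F x = 0 := by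
  rw [contactResolvent, lintegral_eq_zero_iff (measurable_discountedOccupation α hF)] at h
  refine lintegral_eq_zero_of_ae_eq_zero (h.mono fun ω hω => ?_)
  have hm : Measurable fun r : ℝ => ENNReal.ofReal (Real.exp (-α * r)) *
      (staysInside D r.toNNReal).indicator (fun ω => F (ω r.toNNReal)) ω :=
    (measurable_discountedOccupation_integrand α hF).comp (measurable_prodMk_left (x := ω))
  have h1 := (lintegral_eq_zero_iff hm).mp hω
  refine lintegral_eq_zero_of_ae_eq_zero (h1.mono fun r hr => ?_)
  rcases mul_eq_zero.mp hr with h2 | h2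
  · exact absurd h2 (ENNReal.ofReal_pos.mpr (Real.exp_pos _)).ne'
  · change _ * _ = 0
    rw [h2, mul_zero]

theorem expFunctional_const (α : ℝ) (t : ℝ≥0) (ω : CadlagPath d) :
    expFunctional (fun _ => α) t ω = Real.exp (-α * t) := by
  simp [expFunctional, mul_comm]

/-- Minus the resolvent, extended by zero outside `D`, is a weak subsolution of
`(-A + α) v = 0`. -/
theorem isWeakSubsolution_neg_resolvent (hQb : LocalCoeffCond Q b) (hN : LevyKernelCond N)
    (hP : IsStrongMarkovSolution Q b N P) (hD : IsOpen D) {α : ℝ} (hα : 0 < α)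
    {F : Euc d → ℝ≥0∞} (hF : Measurable F) {C : ℝ≥0} (hC : ∀ x, F x ≤ C) :
    IsWeakSubsolution P D (fun _ => α)
      (fun x => -D.indicator (fun y => (contactResolvent P D α F y).toReal) x) := by
  have := hP.isMarkovKernel
  obtain ⟨K, hK⟩ := exists_contactResolvent_le (P := P) (D := D) hα hC
  have hRm := measurable_contactResolvent (P := P) (D := D) α hF
  have hRK : ∀ x, (contactResolvent P D α F x).toReal ≤ K := fun x =>
    ENNReal.toReal_le_coe_of_le_coe (hK x)
  refine ⟨(hRm.ennreal_toReal.indicator hD.measurableSet).neg, ⟨K, fun x => ?_⟩, fun x hx t => ?_⟩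
  · rw [abs_neg, abs_of_nonneg (indicator_nonneg (fun _ _ => ENNReal.toReal_nonneg) x)]
    exact indicator_le' (fun _ _ => hRK _) (fun _ _ => K.coe_nonneg) x
  have hset := (natFiltration d).le t _ (measurableSet_staysInside (D := D) t)
  have hcongr : ∀ᵐ ω ∂(P x), expFunctional (fun _ => α) (exitTimeMin D t ω) ω *
      (-D.indicator (fun y => (contactResolvent P D α F y).toReal) (ω (exitTimeMin D t ω))) =
      -(staysInside D t).indicator (fun ω => (ENNReal.ofReal (Real.exp (-α * t)) *
        contactResolvent P D α F (ω t)).toReal) ω := by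
    filter_upwards [ae_exit hQb hN hP hD hx] with ω hω
    rcases lt_or_ge (t : ℝ≥0∞) (exitTime D ω) with h | h
    · have hstay : ω ∈ staysInside D t := lt_contactTime_iff.mp (hω.2.1 ▸ h)
      rw [exitTimeMin_of_lt h, expFunctional_const, indicator_of_mem hstay,
        indicator_of_mem (mem_of_mem_staysInside hstay le_rfl), ENNReal.toReal_mul,
        ENNReal.toReal_ofReal (Real.exp_nonneg _), mul_neg]
    · have hstay : ω ∉ staysInside D t := fun hc =>
        absurd (lt_contactTime_iff.mpr hc) (not_lt.mpr (hω.2.1 ▸ h))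
      rw [indicator_of_notMem hstay,
        indicator_of_notMem (hω.2.2 _ (coe_exitTimeMin_of_le h)).1, neg_zero, mul_zero]
  rw [integral_congr_ae hcongr, integral_neg, integral_indicator hset, indicator_of_mem hx,
    neg_le_neg_iff, integral_toReal]
  · refine ENNReal.toReal_mono ((hK x).trans_lt ENNReal.coe_lt_top).ne ?_
    exact exp_mul_contactResolvent_le hP.strongMarkov x α t hF
  · exact ((hRm.comp (measurable_eval t)).const_mul _).aemeasurable
  · exact Eventually.of_forall fun ω => ENNReal.mul_lt_top ENNReal.ofReal_lt_top
      ((hK _).trans_lt ENNReal.coe_lt_top)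

theorem ResolventIrreducible.of_strongMaxPrinciple (hQb : LocalCoeffCond Q b)
    (hN : LevyKernelCond N) (hP : IsStrongMarkovSolution Q b N P) (hD : IsOpen D)
    {m : Measure (Euc d)}
    (hlim : ∀ f : Euc d → ℝ, IsBddNonnegOn D f → 0 < ∫⁻ x in D, ENNReal.ofReal (f x) ∂m →
      0 < limsup
        (fun α : ℝ => ENNReal.ofReal α * ∫⁻ x in D, killedResolvent P D α f x ∂m) atTop)
    (hSMP : StrongMaxPrinciple N P D m) : ResolventIrreducible P D m := by
  intro f hf hfm x₀ hx₀
  refine pos_iff_ne_zero.mpr fun hzero => ?_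
  have := hP.isMarkovKernel
  set F : Euc d → ℝ≥0∞ := fun y => ENNReal.ofReal (D.indicator f y)
  have hF : Measurable F := (measurable_indicator_of_isBddNonnegOn hD hf).ennreal_ofReal
  obtain ⟨C, hC⟩ : ∃ C : ℝ≥0, ∀ x, F x ≤ C := by
    obtain ⟨C, hC⟩ := hf.2
    refine ⟨C.toNNReal, fun x => ?_⟩
    by_cases hx : x ∈ D
    · simp only [F, indicator_of_mem hx]
      exact ENNReal.ofReal_le_ofReal (hC x hx).2
    · simp only [F, indicator_of_notMem hx, ENNReal.ofReal_zero]
      exact zero_le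
  rw [killedResolvent_eq hQb hN hP hD hx₀ 1 hf] at hzero
  have hint : ∀ α : ℝ, 0 < α → ∫⁻ x in D, killedResolvent P D α f x ∂m = 0 := by
    intro α hα
    set u : Euc d → ℝ :=
      fun x => -D.indicator (fun y => (contactResolvent P D α F y).toReal) x
    have hu : IsWeakSubsolution P D (fun _ => α) u :=
      isWeakSubsolution_neg_resolvent hQb hN hP hD hα hF hC
    have hu0 : u x₀ = 0 := by
      simp only [u]
      rw [indicator_of_mem hx₀, contactResolvent_eq_zero_of_eq_zero hF hzero]
      simp
    have hsup : sSup (u '' extDomain N D) = 0 := by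
      refine IsGreatest.csSup_eq ⟨⟨x₀, Or.inr hx₀, hu0⟩, ?_⟩
      rintro _ ⟨y, -, rfl⟩
      exact neg_nonpos.mpr (indicator_nonneg (fun _ _ => ENNReal.toReal_nonneg) y)
    have hα' : IsBddNonnegOn D fun _ => α := ⟨measurable_const, α, fun _ _ => ⟨hα.le, le_rfl⟩⟩
    have hae := hSMP _ hα' u hu x₀ hx₀ (hu0.trans hsup.symm) hsup.ge
    rw [hsup] at hae
    obtain ⟨K, hK⟩ := exists_contactResolvent_le (P := P) (D := D) hα hC
    refine lintegral_eq_zero_of_ae_eq_zero ?_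
    filter_upwards [hae, ae_restrict_mem hD.measurableSet] with x hx hxD
    rw [killedResolvent_eq hQb hN hP hD hxD α hf]
    simp only [u] at hx
    rw [indicator_of_mem hxD, neg_eq_zero, ENNReal.toReal_eq_zero_iff] at hx
    exact hx.resolve_right ((hK x).trans_lt ENNReal.coe_lt_top).ne
  have hlim0 : limsup (fun α : ℝ => ENNReal.ofReal α *
      ∫⁻ x in D, killedResolvent P D α f x ∂m) atTop = 0 := by
    rw [limsup_congr (v := fun _ => 0), limsup_const]
    filter_upwards [eventually_gt_atTop 0] with α hα
    rw [hint α hα, mul_zero]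
  exact absurd hlim0 (hlim f hf hfm).ne'

end Irreducible

end

theorem theorem3p2 {d : ℕ}
    (Q : Euc d → Matrix (Fin d) (Fin d) ℝ) (b : Euc d → Euc d) (N : Kernel (Euc d) (Euc d))
    (hQb : LocalCoeffCond Q b) (hN : LevyKernelCond N)
    (P : Kernel (Euc d) (CadlagPath d)) (hP : IsStrongMarkovSolution Q b N P)
    (D : Set (Euc d)) (hD_open : IsOpen D) (hD_conn : IsConnected D)
    (hET : ExitTimeFinite P D)
    (m : Measure (Euc d)) [SigmaFinite m] (hm : m D ≠ 0) :
    (ResolventIrreducible P D m → StrongMaxPrinciple N P D m) ∧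
    ((∀ f : Euc d → ℝ, IsBddNonnegOn D f → 0 < ∫⁻ x in D, ENNReal.ofReal (f x) ∂m →
        0 < limsup
          (fun α : ℝ => ENNReal.ofReal α * ∫⁻ x in D, killedResolvent P D α f x ∂m) atTop) →
      StrongMaxPrinciple N P D m → ResolventIrreducible P D m) := by
  exact ⟨StrongMaxPrinciple.of_resolventIrreducible hQb hN hP hD_open,
    ResolventIrreducible.of_strongMaxPrinciple hQb hN hP hD_open⟩
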